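/- Let $\mathbb{F}$ be an algebraically closed field. An affine variety $V\subseteq\mathbb{A}^n=\mathbb{F}^n$ is the (possibly reducible or empty) set of common zeros of a set of polynomials in $\mathbb{F}[X_1,\dots,X_n]$. Its dimension is the maximal $r$ for which there is a chain $V_0\subsetneq V_1\subsetneq\dots\subsetneq V_r$ of irreducible subvarieties of $V$ ($-\infty$ if $V=\emptyset$). The degree of an irreducible $V$ is the number of points in which $V$ meets an affine subspace of codimension $\dim V$ in general position, and the degree of an arbitrary $V$ is the sum of the degrees of its irreducible components. A polynomial map $\varphi:\mathbb{A}^n\to\mathbb{A}^m$, $1\le m\le n$, is an $(n,m,k,d)$ deterministic rank condenser for varieties if $\dim\overline{\varphi(V)}=\dim V$ (Zariski closure) for every affine variety $V\subseteq\mathbb{A}^n$ of dimension at most $k$ and degree at most $d$; if $k=m$ it is called an $(n,m,d)$ deterministic rank extractor. (1) Let $n,d\ge 1$ and $m,k\in\{1,\dots,n\}$, let $d_1,\dots,d_n>d$ be pairwise coprime integers, and let $M=(c_{i,j})\in\mathbb{F}^{m\times n}$ be $k$-regular, i.e. any $k$ distinct columns of $M$ are linearly independent. Let $$\varphi:\mathbb{A}^n\to\mathbb{A}^m,\qquad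 \varphi(a)=\Big(\sum_{j=1}^n c_{i,j}a_j^{d_j}\Big)_{i=1}^m .$$ Then for every affine variety $V\subseteq\mathbb{A}^n$ of dimension at most $k$ and degree at most $d$ and every $b\in\mathbb{A}^m$, the fiber $\varphi^{-1}(b)\cap V$ is finite. Moreover $\varphi$ is an $(n,m,k,d)$ deterministic rank condenser; in particular, if $m=k$, it is an $(n,m,d)$ deterministic rank extractor. (2) There are an absolute constant $C$ and an algorithm that, given $n,d\ge1$ and $m\in\{1,n-1,n\}$ with $m\ge 1$, outputs sparse representations of integer polynomials $f_1,\dots,f_m$ of the form $f_i=\sum_{j=1}^n c_{i,j}X_j^{d_j}$, where $d_1,\dots,d_n>d$ are pairwise coprime, such that all coefficients of the $f_i$ lie in $\{0,1,-1\}$ and, over every algebraically closed field $\mathbb{F}$, $(f_1,\dots,f_m)$ defines an $(n,m,d)$ deterministic rank extractor. The degrees satisfy $\deg f_i\le C(n+d)\log_2(n+d)$ and the running time is at most $C(n+d)^C$. (3) The same holds, with another algorithm and constant $C$, with running time at most $C(n+\lfloor\log_2 d\rfloor)^C$ and degrees $\deg f_i\le C\,nd\log_2(n+1)$. Running times are measured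 on a random access machine with logarithmic (bit) cost. -/

import Mathlib

universe u

noncomputable section

namespace RankExtractor

section Varieties

variable {F : Type u} [Field F] {n m : ℕ}

/-- Affine varieties in affine `n`-space over an algebraically closed field: the sets of common
zeros of sets (equivalently, ideals) of polynomials. They may be reducible or empty. -/
def IsAffineVariety (V : Set (Fin n → F)) : Prop :=
  ∃ I : Ideal (MvPolynomial (Fin n) F), V = MvPolynomial.zeroLocus F I

/-- Irreducible affine varieties; the empty set is not irreducible. -/
def IsIrreducibleVariety (V : Set (Fin n → F)) : Prop :=
  IsAffineVariety V ∧ V.Nonempty ∧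
    ∀ A B : Set (Fin n → F), IsAffineVariety A → IsAffineVariety B →
      V = A ∪ B → V = A ∨ V = B

/-- The irreducible components of `V`: the maximal irreducible subvarieties. -/
def components (V : Set (Fin n → F)) : Set (Set (Fin n → F)) :=
  {W | Maximal (fun W' => IsIrreducibleVariety W' ∧ W' ⊆ V) W}

/-- The dimension of `V`: the supremum of the lengths `r` of chains `V₀ ⊊ V₁ ⊊ ⋯ ⊊ Vᵣ` of
irreducible subvarieties of `V` (with value `⊥` for the empty variety). -/
def dim (V : Set (Fin n → F)) : WithBot ℕ∞ :=
  Order.krullDim {W : Set (Fin n → F) // IsIrreducibleVariety W ∧ W ⊆ V}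

/-- `D` is the number of intersection points of `V` with an affine subspace of codimension
`dim V` in general position: outside of a proper closed subset (contained in `G = 0`) of the
space of all `(A, b)`, the subspace `A x = b` of codimension `dim V` meets `V` in exactly `D`
points. -/
def IsGenericSectionNumber (V : Set (Fin n → F)) (D : ℕ∞) : Prop :=
  ∃ r : ℕ, dim V = r ∧ ∃ G : MvPolynomial ((Fin r × Fin n) ⊕ Fin r) F, G ≠ 0 ∧
    ∀ (A : Matrix (Fin r) (Fin n) F) (b : Fin r → F), LinearIndependent F A.row →
      MvPolynomial.eval (Sum.elim (fun p => A p.1 p.2) b) G ≠ 0 →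
        (V ∩ {x | A.mulVec x = b}).encard = D

/-- The degree of an irreducible variety. (Over an algebraically closed field there is exactly
one generic section number, so the infimum is over a singleton.) -/
def irreducibleDegree (V : Set (Fin n → F)) : ℕ∞ :=
  sInf {D | IsGenericSectionNumber V D}

/-- The degree of an affine variety: the sum of the degrees of its (finitely many) irreducible
components, of whatever dimensions. -/
def degree (V : Set (Fin n → F)) : ℕ∞ :=
  ∑ᶠ W ∈ components V, irreducibleDegree W

/-- The Zariski closure. -/
def zariskiClosure (S : Set (Fin n → F)) : Set (Fin n → F) :=
  MvPolynomial.zeroLocus F (MvPolynomial.vanishingIdeal F S)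

/-- The polynomial map from affine `n`-space to affine `m`-space defined by `f₁, …, fₘ`. -/
def polyMap (f : Fin m → MvPolynomial (Fin n) F) (a : Fin n → F) : Fin m → F :=
  fun i => MvPolynomial.eval a (f i)

/-- `(n, m, k, d)` deterministic (lossless) rank condensers for varieties. -/
def IsRankCondenser (k d : ℕ) (f : Fin m → MvPolynomial (Fin n) F) : Prop :=
  ∀ V : Set (Fin n → F), IsAffineVariety V → dim V ≤ (k : WithBot ℕ∞) → degree V ≤ (d : ℕ∞) →
    dim (zariskiClosure (polyMap f '' V)) = dim V

/-- `(n, m, d)` deterministic (lossless) rank extractors for varieties. -/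
def IsRankExtractor (d : ℕ) (f : Fin m → MvPolynomial (Fin n) F) : Prop :=
  IsRankCondenser m d f

/-- A matrix is `k`-regular if any `k` distinct columns are linearly independent. -/
def IsRegularMatrix (k : ℕ) (M : Matrix (Fin m) (Fin n) F) : Prop :=
  ∀ s : Finset (Fin n), s.card = k → LinearIndependent F (fun j : s => M.col j)

end Varieties

/-- The polynomials `∑ⱼ c i j * Xⱼ ^ eⱼ`. -/
def diagonalPolys {R : Type u} [CommRing R] {n m : ℕ} (c : Matrix (Fin m) (Fin n) R)
    (e : Fin n → ℕ) : Fin m → MvPolynomial (Fin n) R :=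
  fun i => ∑ j, MvPolynomial.C (c i j) * MvPolynomial.X j ^ e j

section Machine

/-! Random access machines with logarithmic (bit) cost, programmed in structured form. -/

/-- Programs. Registers are numbered by naturals and hold naturals; `load` and `store` are the
instructions with indirect addressing, `write` appends to a write-only output tape. -/
inductive Program : Type
  | skip : Program
  | const (dst value : ℕ) : Program
  | add (dst a b : ℕ) : Program
  | sub (dst a b : ℕ) : Program
  | mul (dst a b : ℕ) : Program
  | div (dst a b : ℕ) : Program
  | mod (dst a b : ℕ) : Program
  | load (dst addr : ℕ) : Program
  | store (addr src : ℕ) : Program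
  | write (src : ℕ) : Program
  | seq (p q : Program) : Program
  | ifNonzero (test : ℕ) (p q : Program) : Program
  | whileNonzero (test : ℕ) (body : Program) : Program

/-- A machine state: contents of the registers and of the output tape. -/
structure State : Type where
  mem : ℕ → ℕ
  out : List ℕ

/-- The state after writing `v` into register `r`. -/
def State.set (s : State) (r v : ℕ) : State :=
  ⟨Function.update s.mem r v, s.out⟩

/-- The cost of handling the number `x`: the length of its binary expansion, plus one. -/
def bitCost (x : ℕ) : ℕ := x.size + 1

/-- `Exec p s s' t`: started in the state `s`, the program `p` halts in the state `s'`, and the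
total logarithmic cost of the executed instructions is `t`. -/
inductive Exec : Program → State → State → ℕ → Prop
  | skip (s : State) : Exec .skip s s 1
  | const (s : State) (dst v : ℕ) : Exec (.const dst v) s (s.set dst v) (bitCost v)
  | add (s : State) (dst a b : ℕ) :
      Exec (.add dst a b) s (s.set dst (s.mem a + s.mem b)) (bitCost (s.mem a) + bitCost (s.mem b))
  | sub (s : State) (dst a b : ℕ) :
      Exec (.sub dst a b) s (s.set dst (s.mem a - s.mem b)) (bitCost (s.mem a) + bitCost (s.mem b))
  | mul (s : State) (dst a b : ℕ) :
      Exec (.mul dst a b) s (s.set dst (s.mem a * s.mem b)) (bitCost (s.mem a) + bitCost (s.mem b))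
  | div (s : State) (dst a b : ℕ) :
      Exec (.div dst a b) s (s.set dst (s.mem a / s.mem b)) (bitCost (s.mem a) + bitCost (s.mem b))
  | mod (s : State) (dst a b : ℕ) :
      Exec (.mod dst a b) s (s.set dst (s.mem a % s.mem b)) (bitCost (s.mem a) + bitCost (s.mem b))
  | load (s : State) (dst addr : ℕ) :
      Exec (.load dst addr) s (s.set dst (s.mem (s.mem addr)))
        (bitCost (s.mem addr) + bitCost (s.mem (s.mem addr)))
  | store (s : State) (addr src : ℕ) :
      Exec (.store addr src) s (s.set (s.mem addr) (s.mem src))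
        (bitCost (s.mem addr) + bitCost (s.mem src))
  | write (s : State) (src : ℕ) :
      Exec (.write src) s ⟨s.mem, s.out ++ [s.mem src]⟩ (bitCost (s.mem src))
  | seq (p q : Program) (s s' s'' : State) (t t' : ℕ) :
      Exec p s s' t → Exec q s' s'' t' → Exec (.seq p q) s s'' (t + t')
  | ifTrue (r : ℕ) (p q : Program) (s s' : State) (t : ℕ) :
      s.mem r ≠ 0 → Exec p s s' t → Exec (.ifNonzero r p q) s s' (bitCost (s.mem r) + t)
  | ifFalse (r : ℕ) (p q : Program) (s s' : State) (t : ℕ) :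
      s.mem r = 0 → Exec q s s' t → Exec (.ifNonzero r p q) s s' (bitCost (s.mem r) + t)
  | whileStep (r : ℕ) (p : Program) (s s' s'' : State) (t t' : ℕ) :
      s.mem r ≠ 0 → Exec p s s' t → Exec (.whileNonzero r p) s' s'' t' →
        Exec (.whileNonzero r p) s s'' (bitCost (s.mem r) + t + t')
  | whileDone (r : ℕ) (p : Program) (s : State) :
      s.mem r = 0 → Exec (.whileNonzero r p) s s (bitCost (s.mem r))

/-- The initial state: the input in the first registers, zero in all others, no output. -/
def initState (input : List ℕ) : State :=
  ⟨fun r => input.getD r 0, []⟩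

/-- On the given input, the program halts with the given output, in time (cost) at most `T`. -/
def OutputsInTime (p : Program) (input output : List ℕ) (T : ℕ) : Prop :=
  ∃ (s : State) (t : ℕ), Exec p (initState input) s t ∧ s.out = output ∧ t ≤ T

end Machine

section SparseRepresentation

variable {n m : ℕ}

/-- A sparse representation of `p`: a list of its nonzero terms (exponent vector, coefficient),
in some order, without repetition. -/
def IsSparseRep (p : MvPolynomial (Fin n) ℤ) (l : List ((Fin n →₀ ℕ) × ℤ)) : Prop :=
  (l.map Prod.fst).Nodup ∧ (∀ t ∈ l, t.2 ≠ 0) ∧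
    (l.map fun t => MvPolynomial.monomial t.1 t.2).sum = p

/-- A term is written as sign (`1` if negative), absolute value of the coefficient, and the `n`
exponents. -/
def encodeTerm (t : (Fin n →₀ ℕ) × ℤ) : List ℕ :=
  [if t.2 < 0 then 1 else 0, t.2.natAbs] ++ List.ofFn (fun j => t.1 j)

/-- A list of terms is written as the number of the terms followed by the terms. -/
def encodeTerms (l : List ((Fin n →₀ ℕ) × ℤ)) : List ℕ :=
  l.length :: l.flatMap encodeTerm

/-- `w` consists of sparse representations of `f₁, …, fₘ`, one after the other. -/
def IsSparseEncoding (f : Fin m → MvPolynomial (Fin n) ℤ) (w : List ℕ) : Prop :=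
  ∃ l : Fin m → List ((Fin n →₀ ℕ) × ℤ), (∀ i, IsSparseRep (f i) (l i)) ∧
    w = (List.ofFn l).flatMap encodeTerms

end SparseRepresentation

/-- The program `prog` is an explicit construction of `(n, m, d)` deterministic rank extractors
for all `n, d ≥ 1` and all `m ∈ {1, n - 1, n}`, `m ≥ 1`, with degrees at most `degBound n d` and
in time at most `timeBound n d`. On input `(n, m, d)` it writes sparse representations of
polynomials `fᵢ = ∑ⱼ cᵢⱼ Xⱼ ^ eⱼ` with all coefficients in `{0, 1, -1}` and pairwise coprime
exponents `eⱼ > d`, which define a rank extractor over every algebraically closed field. -/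
def IsExplicitExtractorConstruction (prog : Program) (degBound : ℕ → ℕ → ℝ)
    (timeBound : ℕ → ℕ → ℕ) : Prop :=
  ∀ n m d : ℕ, 1 ≤ n → 1 ≤ d → 1 ≤ m → (m = 1 ∨ m + 1 = n ∨ m = n) →
    ∃ (c : Matrix (Fin m) (Fin n) ℤ) (e : Fin n → ℕ) (w : List ℕ),
      (∀ i j, c i j = 0 ∨ c i j = 1 ∨ c i j = -1) ∧
      (∀ j, d < e j) ∧ Pairwise (fun j j' => Nat.Coprime (e j) (e j')) ∧
      (∀ i s, (diagonalPolys c e i).coeff s = 0 ∨ (diagonalPolys c e i).coeff s = 1 ∨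
        (diagonalPolys c e i).coeff s = -1) ∧
      (∀ i, ((diagonalPolys c e i).totalDegree : ℝ) ≤ degBound n d) ∧
      IsSparseEncoding (diagonalPolys c e) w ∧
      OutputsInTime prog [n, m, d] w (timeBound n d) ∧
      ∀ (F : Type u) [Field F] [IsAlgClosed F],
        IsRankExtractor d
          (fun i => MvPolynomial.map (Int.castRingHom F) (diagonalPolys c e i))

end RankExtractor

end

/-!
Let `W` be an irreducible variety of dimension `r ≤ k` and degree at most `d`. Any `r + 1` of its
coordinates satisfy a nonzero polynomial relation of total degree at most `d`: after a generic
linear change of the coordinates a minimal relation is separable and of full degree in one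
variable, so it bounds from below the number of points of `W` over a generic point, and these points
lie on an affine subspace of codimension `r` in general position.

Suppose that some coordinate of `W` is not integral over the ring generated by the polynomials
`∑ⱼ c i j * Xⱼ ^ eⱼ`. Then there is a valuation which is at most one on this ring, but greater than
one at the coordinate. As `k` columns of `c` are always linearly independent, the maximal valuation
of the `xⱼ ^ eⱼ` is attained more than `k` times, since otherwise a combination of the polynomials
isolates one of the terms of maximal valuation. For `r + 1` such coordinates, the monomials with all
exponents at most `d` have pairwise distinct valuations, because the `eⱼ > d` are pairwise coprime,
so no relation of degree at most `d` holds between them. Hence the polynomial map is integral on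
every variety in question: its fibers are finite and it preserves the dimension.

For the explicit constructions, the exponents are successive primes greater than `d`, or the least
powers greater than `d` of the first primes. An identity matrix, possibly followed by a column of
ones, or a single row of ones, is regular over every field.
-/

noncomputable section

namespace RankExtractor

/-! ### Krull dimension and transcendence degree -/

theorem ringKrullDim_eq_of_isIntegral {S R : Type*} [CommRing S] [CommRing R] [Algebra S R]
    [Algebra.IsIntegral S R] (hinj : Function.Injective (algebraMap S R)) :
    ringKrullDim R = ringKrullDim S := by
  apply le_antisymm
  · exact Order.krullDim_le_of_strictMono (PrimeSpectrum.comap (algebraMap S R))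
      fun I _ hIJ => Ideal.IsIntegral.comap_lt_comap (I := I.asIdeal) hIJ
  · refine iSup_le fun l => ?_
    obtain ⟨Q, -, hQ, hQl⟩ := Ideal.exists_ideal_over_prime_of_isIntegral (S := R)
      (RelSeries.head l).asIdeal ⊥ (by simp [← RingHom.ker_eq_comap_bot,
        (RingHom.injective_iff_ker_eq_bot _).1 hinj])
    have : Q.LiesOver (RelSeries.head l).asIdeal := ⟨hQl.symm⟩
    obtain ⟨L, hL, -⟩ := Ideal.exists_ltSeries_of_hasGoingUp l Q
    rw [← hL]
    exact le_iSup (fun p : LTSeries (PrimeSpectrum R) => (p.length : WithBot ℕ∞)) L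

theorem ringKrullDim_eq_trdeg (F R : Type*) [Field F] [CommRing R] [IsDomain R] [Algebra F R]
    [Algebra.FiniteType F R] :
    ringKrullDim R = (Cardinal.toENat (Algebra.trdeg F R) : WithBot ℕ∞) := by
  obtain ⟨s, g, hinj, hint⟩ := exists_integral_inj_algHom_of_fg F R
  let _ := g.toRingHom.toAlgebra
  have : Algebra.IsIntegral (MvPolynomial (Fin s) F) R := ⟨hint⟩
  have : FaithfulSMul (MvPolynomial (Fin s) F) R :=
    (faithfulSMul_iff_algebraMap_injective _ _).2 hinj
  have : IsScalarTower F (MvPolynomial (Fin s) F) R :=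
    .of_algebraMap_eq fun a => (g.commutes a).symm
  have htrdeg : Algebra.trdeg F R = s := by
    have h := lift_trdeg_add_eq F (MvPolynomial (Fin s) F) R
    rw [trdeg_eq_zero (R := MvPolynomial (Fin s) F), Cardinal.lift_zero, add_zero,
      MvPolynomial.trdeg_of_isDomain] at h
    simpa using h.symm
  rw [ringKrullDim_eq_of_isIntegral hinj, htrdeg]
  simp [ringKrullDim_eq_zero_of_field]

/-! ### Varieties and ideals -/

section Varieties

open MvPolynomial

theorem vanishingIdeal_union {σ k K : Type*} [Field k] [Field K] [Algebra k K]
    (A B : Set (σ → K)) :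
    vanishingIdeal k (A ∪ B) = vanishingIdeal k A ⊓ vanishingIdeal k B :=
  zeroLocus_vanishingIdeal_galoisConnection.u_inf

theorem zeroLocus_sup {σ k : Type*} (K : Type*) [Field k] [Field K] [Algebra k K]
    (I J : Ideal (MvPolynomial σ k)) :
    zeroLocus K (I ⊔ J) = zeroLocus K I ∩ zeroLocus K J :=
  zeroLocus_vanishingIdeal_galoisConnection.l_sup

variable {F : Type u} [Field F] {n : ℕ} {V W : Set (Fin n → F)}

theorem isAffineVariety_zeroLocus (I : Ideal (MvPolynomial (Fin n) F)) :
    IsAffineVariety (zeroLocus F I) := ⟨I, rfl⟩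

theorem IsAffineVariety.inter (hV : IsAffineVariety V) (hW : IsAffineVariety W) :
    IsAffineVariety (V ∩ W) := by
  obtain ⟨I, rfl⟩ := hV
  obtain ⟨J, rfl⟩ := hW
  exact ⟨I ⊔ J, (zeroLocus_sup F I J).symm⟩

theorem IsAffineVariety.zeroLocus_vanishingIdeal (hV : IsAffineVariety V) :
    zeroLocus F (vanishingIdeal F V) = V := by
  obtain ⟨I, rfl⟩ := hV
  exact zeroLocus_vanishingIdeal_galoisConnection.l_u_l_eq_l I

theorem IsAffineVariety.zeroLocus_subset (hV : IsAffineVariety V)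
    {I : Ideal (MvPolynomial (Fin n) F)} (hI : vanishingIdeal F V ≤ I) : zeroLocus F I ⊆ V :=
  (zeroLocus_anti_mono hI).trans hV.zeroLocus_vanishingIdeal.subset

theorem IsIrreducibleVariety.isPrime_vanishingIdeal (hV : IsIrreducibleVariety V) :
    (vanishingIdeal F V).IsPrime := by
  obtain ⟨hV, ⟨x, hx⟩, hirr⟩ := hV
  refine ⟨fun htop => ?_, fun {p q} hpq => ?_⟩
  · have hone : (1 : MvPolynomial (Fin n) F) ∈ vanishingIdeal F V := htop ▸ Submodule.mem_top
    simpa using hone x hx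
  · let Z (f : MvPolynomial (Fin n) F) : Set (Fin n → F) := {y | aeval y f = 0}
    have hZ (f) : IsAffineVariety (Z f) :=
      ⟨Ideal.span {f}, by rw [zeroLocus_span]; simp [Z]⟩
    have hcover : V = V ∩ Z p ∪ V ∩ Z q := by
      rw [← Set.inter_union_distrib_left, eq_comm, Set.inter_eq_left]
      intro y hy
      simpa [Z] using hpq y hy
    exact (hirr _ _ (hV.inter (hZ p)) (hV.inter (hZ q)) hcover).imp
      (fun h _ hy => (h ▸ hy : _ ∈ V ∩ Z p).2) (fun h _ hy => (h ▸ hy : _ ∈ V ∩ Z q).2)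

theorem dim_mono (h : W ⊆ V) : dim W ≤ dim V :=
  Order.krullDim_le_of_strictMono (fun U => ⟨U.1, U.2.1, U.2.2.trans h⟩) fun _ _ hU => hU

theorem exists_isGenericSectionNumber_le {d : ℕ} (h : irreducibleDegree W ≤ d) :
    ∃ D ≤ d, IsGenericSectionNumber W D := by
  have hne : {D | IsGenericSectionNumber W D}.Nonempty := by
    by_contra hempty
    simp [irreducibleDegree, Set.not_nonempty_iff_eq_empty.1 hempty] at h
  obtain ⟨D, hD⟩ := ENat.ne_top_iff_exists.1 (ne_top_of_le_ne_top (ENat.natCast_ne_top d) h)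
  refine ⟨D, by exact_mod_cast hD ▸ h, ?_⟩
  rw [hD]
  exact csInf_mem hne

variable [IsAlgClosed F]

theorem isIrreducibleVariety_zeroLocus (P : Ideal (MvPolynomial (Fin n) F)) [hP : P.IsPrime] :
    IsIrreducibleVariety (zeroLocus F P) := by
  have hVP : vanishingIdeal F (zeroLocus F P) = P := IsPrime.vanishingIdeal_zeroLocus P
  refine ⟨isAffineVariety_zeroLocus P, ?_, fun A B hA hB hAB => ?_⟩
  · rw [Set.nonempty_iff_ne_empty]
    intro hempty
    rw [hempty, vanishingIdeal_empty] at hVP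
    exact hP.ne_top hVP.symm
  · have hle : vanishingIdeal F A ≤ P ∨ vanishingIdeal F B ≤ P := by
      rw [← Ideal.IsPrime.inf_le hP, ← vanishingIdeal_union, ← hAB, hVP]
    exact hle.imp
      (fun h => (hA.zeroLocus_subset h).antisymm (hAB ▸ Set.subset_union_left))
      (fun h => (hB.zeroLocus_subset h).antisymm (hAB ▸ Set.subset_union_right))

/-- Irreducible subvarieties of `V` correspond to the primes containing the ideal of `V`. -/
def irreducibleSubvarietiesOrderIso (hV : IsAffineVariety V) :
    {W : Set (Fin n → F) // IsIrreducibleVariety W ∧ W ⊆ V} ≃o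
      (PrimeSpectrum.zeroLocus (vanishingIdeal F V : Set (MvPolynomial (Fin n) F)))ᵒᵈ where
  toFun W := OrderDual.toDual ⟨⟨vanishingIdeal F W.1, W.2.1.isPrime_vanishingIdeal⟩,
    vanishingIdeal_anti_mono W.2.2⟩
  invFun P := ⟨zeroLocus F (OrderDual.ofDual P).1.asIdeal,
    isIrreducibleVariety_zeroLocus _, hV.zeroLocus_subset (OrderDual.ofDual P).2⟩
  left_inv W := Subtype.ext W.2.1.1.zeroLocus_vanishingIdeal
  right_inv P := OrderDual.ofDual.injective <| Subtype.ext <| PrimeSpectrum.ext <|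
    IsPrime.vanishingIdeal_zeroLocus _
  map_rel_iff' {W W'} := by
    constructor
    · intro (h : vanishingIdeal F W'.1 ≤ vanishingIdeal F W.1)
      exact (le_zeroLocus_iff_le_vanishingIdeal.2 h).trans W'.2.1.1.zeroLocus_vanishingIdeal.le
    · exact vanishingIdeal_anti_mono

theorem dim_eq_ringKrullDim (hV : IsAffineVariety V) :
    dim V = ringKrullDim (MvPolynomial (Fin n) F ⧸ vanishingIdeal F V) := by
  rw [dim, Order.krullDim_eq_of_orderIso (irreducibleSubvarietiesOrderIso hV),
    Order.krullDim_orderDual, ringKrullDim_quotient]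

theorem components_eq_image (hV : IsAffineVariety V) :
    components V = zeroLocus F '' (vanishingIdeal F V).minimalPrimes := by
  ext W
  constructor
  · rintro ⟨⟨hW, hWV⟩, hmax⟩
    refine ⟨vanishingIdeal F W, ⟨⟨hW.isPrime_vanishingIdeal, vanishingIdeal_anti_mono hWV⟩, ?_⟩,
      hW.1.zeroLocus_vanishingIdeal⟩
    rintro P ⟨hP, hVP⟩ hPW
    have hle := hmax ⟨isIrreducibleVariety_zeroLocus P, hV.zeroLocus_subset hVP⟩
      (le_zeroLocus_iff_le_vanishingIdeal.2 hPW)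
    exact (vanishingIdeal_anti_mono hle).trans (IsPrime.vanishingIdeal_zeroLocus P).le
  · rintro ⟨P, ⟨⟨hP, hVP⟩, hmin⟩, rfl⟩
    refine ⟨⟨isIrreducibleVariety_zeroLocus P, hV.zeroLocus_subset hVP⟩, ?_⟩
    rintro W ⟨hW, hWV⟩ hPW
    have hle : vanishingIdeal F W ≤ P :=
      (vanishingIdeal_anti_mono hPW).trans (IsPrime.vanishingIdeal_zeroLocus P).le
    exact le_zeroLocus_iff_le_vanishingIdeal.2
      (hmin ⟨hW.isPrime_vanishingIdeal, vanishingIdeal_anti_mono hWV⟩ hle)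

theorem finite_components (hV : IsAffineVariety V) : (components V).Finite := by
  rw [components_eq_image hV]
  exact (Ideal.finite_minimalPrimes_of_isNoetherianRing _ _).image _

theorem exists_mem_components (hV : IsAffineVariety V) {x : Fin n → F} (hx : x ∈ V) :
    ∃ W ∈ components V, x ∈ W := by
  obtain ⟨P, hP, hPx⟩ := Ideal.exists_minimalPrimes_le (I := vanishingIdeal F V)
    (J := vanishingIdeal F {x}) (vanishingIdeal_anti_mono (by simpa using hx))
  exact ⟨zeroLocus F P, components_eq_image hV ▸ ⟨P, hP, rfl⟩, fun p hp => hPx hp x rfl⟩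

theorem irreducibleDegree_le_degree (hV : IsAffineVariety V) (hW : W ∈ components V) :
    irreducibleDegree W ≤ degree V := by
  classical
  rw [degree, finsum_mem_eq_finite_toFinset_sum _ (finite_components hV)]
  exact Finset.single_le_sum (f := irreducibleDegree) (fun _ _ => zero_le) (by simpa using hW)

end Varieties

/-! ### The valuation argument -/

section Valuation

open Finset

theorem sum_mul_prod_erase_modEq {ι : Type*} [Fintype ι] [DecidableEq ι] (e c : ι → ℕ) (i : ι) :
    ∑ l, c l * ∏ j ∈ univ.erase l, e j ≡ c i * ∏ j ∈ univ.erase i, e j [MOD e i] := by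
  have hrest : ∑ l ∈ univ.erase i, c l * ∏ j ∈ univ.erase l, e j ≡ 0 [MOD e i] := by
    refine Nat.modEq_zero_iff_dvd.2 (dvd_sum fun l hl => (dvd_prod_of_mem e ?_).mul_left _)
    exact mem_erase.2 ⟨(ne_of_mem_erase hl).symm, mem_univ i⟩
  rw [← add_sum_erase _ _ (mem_univ i)]
  exact hrest.add_left (c i * ∏ j ∈ univ.erase i, e j)

theorem eq_of_sum_mul_prod_erase_eq {ι : Type*} [Fintype ι] [DecidableEq ι] {e a b : ι → ℕ}
    (he : Pairwise fun i j => Nat.Coprime (e i) (e j)) (ha : ∀ i, a i < e i) (hb : ∀ i, b i < e i)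
    (h : ∑ i, a i * ∏ j ∈ univ.erase i, e j = ∑ i, b i * ∏ j ∈ univ.erase i, e j) : a = b := by
  funext i
  have hcoprime : Nat.Coprime (e i) (∏ j ∈ univ.erase i, e j) :=
    Nat.Coprime.prod_right fun j hj => he (ne_of_mem_erase hj).symm
  have hmod : a i ≡ b i [MOD e i] := Nat.ModEq.cancel_right_of_coprime hcoprime
    ((sum_mul_prod_erase_modEq e a i).symm.trans (h ▸ sum_mul_prod_erase_modEq e b i))
  exact hmod.eq_of_lt_of_lt (ha i) (hb i)

theorem eq_of_prod_pow_eq {Γ : Type*} [LinearOrderedCommGroupWithZero Γ] {ι : Type*} [Fintype ι]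
    {e a b : ι → ℕ} {γ : ι → Γ} {w : Γ}
    (he : Pairwise fun i j => Nat.Coprime (e i) (e j)) (ha : ∀ i, a i < e i) (hb : ∀ i, b i < e i)
    (hw : 1 < w) (hγ : ∀ i, γ i ^ e i = w) (h : ∏ i, γ i ^ a i = ∏ i, γ i ^ b i) : a = b := by
  classical
  have hpow (c : ι → ℕ) :
      (∏ i, γ i ^ c i) ^ ∏ j, e j = w ^ ∑ i, c i * ∏ j ∈ univ.erase i, e j := by
    rw [← prod_pow_eq_pow_sum, ← prod_pow]
    refine prod_congr rfl fun i _ => ?_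
    rw [← hγ i, ← mul_prod_erase univ e (mem_univ i), ← pow_mul, ← pow_mul]
    congr 1
    ring
  apply eq_of_sum_mul_prod_erase_eq he ha hb
  apply pow_right_injective₀ (zero_lt_one.trans hw) hw.ne'
  simp only [← hpow, h]

variable {F K Γ : Type*} [Field F] [Field K] [Algebra F K] [LinearOrderedCommGroupWithZero Γ]

theorem sum_ne_zero_of_valuation_injOn (v : Valuation K Γ) {ι : Type*} {s : Finset ι}
    (hs : s.Nonempty) {f : ι → K} (hf : ∀ i ∈ s, f i ≠ 0)
    (hinj : Set.InjOn (fun i => v (f i)) s) : ∑ i ∈ s, f i ≠ 0 := by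
  classical
  obtain ⟨i, hi, hmax⟩ := s.exists_max_image (fun i => v (f i)) hs
  have hne : v (f i) ≠ 0 := v.ne_zero_iff.2 (hf i hi)
  have hlt : v (∑ j ∈ s.erase i, f j) < v (f i) := v.map_sum_lt hne fun j hj =>
    (hmax j (mem_of_mem_erase hj)).lt_of_ne fun h =>
      ne_of_mem_erase hj (hinj (mem_of_mem_erase hj) hi h)
  rw [← add_sum_erase _ _ hi, ← v.ne_zero_iff, v.map_add_eq_of_lt_left hlt]
  exact hne

theorem valuation_algebraMap_eq_one {v : Valuation K Γ} (hv : ∀ a : F, v (algebraMap F K a) ≤ 1)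
    {a : F} (ha : a ≠ 0) : v (algebraMap F K a) = 1 := by
  refine (hv a).antisymm ?_
  have hinv := hv a⁻¹
  rw [map_inv₀, map_inv₀] at hinv
  exact (inv_le_one₀ (zero_lt_iff.2 (v.ne_zero_iff.2 (by simpa using ha)))).1 hinv

/-- The exponents `aᵢ < eᵢ` are determined by the valuation of the monomial `∏ᵢ xᵢ ^ aᵢ`. -/
theorem aeval_ne_zero_of_valuation_pow_eq {ι : Type*} [Finite ι] {v : Valuation K Γ}
    (hv : ∀ a : F, v (algebraMap F K a) ≤ 1) {e : ι → ℕ}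
    (he : Pairwise fun i j => Nat.Coprime (e i) (e j)) {x : ι → K} {w : Γ} (hw : 1 < w)
    (hx : ∀ i, v (x i) ^ e i = w) {P : MvPolynomial ι F} (hP : P ≠ 0)
    (hdeg : ∀ i, P.totalDegree < e i) : MvPolynomial.aeval x P ≠ 0 := by
  cases nonempty_fintype ι
  have hx0 (i : ι) : x i ≠ 0 := by
    rintro h
    refine (zero_lt_one.trans hw).ne ?_
    rw [← hx i, h, map_zero, zero_pow (Nat.ne_zero_of_lt (hdeg i))]
  have hlt {α : ι →₀ ℕ} (hα : α ∈ P.support) (i : ι) : α i < e i :=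
    ((Finsupp.le_degree i α).trans (MvPolynomial.le_totalDegree hα)).trans_lt (hdeg i)
  have hval {α : ι →₀ ℕ} (hα : α ∈ P.support) :
      v (algebraMap F K (P.coeff α) * ∏ i, x i ^ α i) = ∏ i, v (x i) ^ α i := by
    rw [map_mul, valuation_algebraMap_eq_one hv (MvPolynomial.mem_support_iff.1 hα), one_mul,
      map_prod]
    simp only [map_pow]
  rw [MvPolynomial.aeval_def, MvPolynomial.eval₂_eq']
  refine sum_ne_zero_of_valuation_injOn v (by simpa using hP) (fun α hα => ?_)
    fun α hα β hβ hαβ => ?_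
  · exact mul_ne_zero (by simpa using hα) (prod_ne_zero_iff.2 fun i _ => pow_ne_zero _ (hx0 i))
  · simp only [hval hα, hval hβ] at hαβ
    exact DFunLike.coe_injective (eq_of_prod_pow_eq he (hlt hα) (hlt hβ) hw hx hαβ)

variable {m n k : ℕ} {M : Matrix (Fin m) (Fin n) F}

theorem IsRegularMatrix.exists_dual_col (hM : IsRegularMatrix k M) (hkn : k ≤ n)
    {s : Finset (Fin n)} (hs : s.card ≤ k) {j₀ : Fin n} (hj₀ : j₀ ∈ s) :
    ∃ a : Fin m → F, ∀ j ∈ s, ∑ i, a i * M i j = if j = j₀ then 1 else 0 := by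
  obtain ⟨t, hst, ht⟩ := exists_superset_card_eq hs (by simpa using hkn)
  obtain ⟨g, hg⟩ := (Finsupp.linearCombination F
    (fun j : t => M.col j)).exists_leftInverse_of_injective (LinearMap.ker_eq_bot.2 (hM t ht))
  let φ : (Fin m → F) →ₗ[F] F := Finsupp.lapply ⟨j₀, hst hj₀⟩ ∘ₗ g
  have hφ {j : Fin n} (hj : j ∈ s) : φ (M.col j) = if j = j₀ then 1 else 0 := by
    have := LinearMap.congr_fun hg (Finsupp.single ⟨j, hst hj⟩ 1)
    simp only [LinearMap.comp_apply, Finsupp.linearCombination_single, one_smul,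
      LinearMap.id_apply] at this
    simp only [φ, LinearMap.comp_apply, this, Finsupp.lapply_apply, Finsupp.single_apply,
      Subtype.mk.injEq]
  refine ⟨fun i => φ fun l => if i = l then 1 else 0, fun j hj => ?_⟩
  rw [← hφ hj, LinearMap.pi_apply_eq_sum_univ φ (M.col j)]
  exact sum_congr rfl fun i _ => mul_comm _ _

/-- Otherwise a linear combination of the rows isolates one of the terms of maximal valuation. -/
theorem IsRegularMatrix.lt_card_filter_valuation_eq (hM : IsRegularMatrix k M) (hkn : k ≤ n)
    {v : Valuation K Γ} (hv : ∀ a : F, v (algebraMap F K a) ≤ 1) {y : Fin n → K} {w : Γ}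
    (hw : w ≠ 0) (hle : ∀ j, v (y j) ≤ w) {j₀ : Fin n} (hj₀ : v (y j₀) = w)
    (hrow : ∀ i, v (∑ j, algebraMap F K (M i j) * y j) < w) : k < #{j | v (y j) = w} := by
  classical
  by_contra! hcard
  set S : Finset (Fin n) := {j | v (y j) = w}
  have hj₀S : j₀ ∈ S := by simp [S, hj₀]
  obtain ⟨a, ha⟩ := hM.exists_dual_col hkn hcard hj₀S
  have hv_mul_lt {c : F} {z : K} (hz : v z < w) : v (algebraMap F K c * z) < w := by
    rw [map_mul]
    exact (mul_le_of_le_one_left' (hv c)).trans_lt hz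
  have hcomb : ∑ i, algebraMap F K (a i) * ∑ j, algebraMap F K (M i j) * y j =
      y j₀ + ∑ j ∈ Sᶜ, algebraMap F K (∑ i, a i * M i j) * y j := calc
    _ = ∑ j, algebraMap F K (∑ i, a i * M i j) * y j := by
      simp only [mul_sum, map_sum, map_mul, sum_mul, ← mul_assoc]
      exact sum_comm
    _ = _ := by
      rw [← sum_add_sum_compl S, ← sum_ite_eq_of_mem' S j₀ y hj₀S]
      congr 1
      refine sum_congr rfl fun j hj => ?_
      rw [ha j hj, apply_ite (algebraMap F K), map_one, map_zero, ite_mul, one_mul, zero_mul]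
  have hcomb_lt : v (∑ i, algebraMap F K (a i) * ∑ j, algebraMap F K (M i j) * y j) < w :=
    v.map_sum_lt hw fun i _ => hv_mul_lt (hrow i)
  have hcompl_lt : v (∑ j ∈ Sᶜ, algebraMap F K (∑ i, a i * M i j) * y j) < w :=
    v.map_sum_lt hw fun j hj => hv_mul_lt ((hle j).lt_of_ne (by simpa [S] using hj))
  rw [hcomb, v.map_add_eq_of_lt_left (hj₀ ▸ hcompl_lt), hj₀] at hcomb_lt
  exact hcomb_lt.false

variable {d r : ℕ}

theorem IsRegularMatrix.valuation_le_one (hM : IsRegularMatrix k M) (hkn : k ≤ n) (hr : r ≤ k)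
    {e : Fin n → ℕ} (hd : ∀ j, d < e j) (he : Pairwise fun j j' => Nat.Coprime (e j) (e j'))
    {x : Fin n → K}
    (hrel : ∀ T : Fin (r + 1) ↪ Fin n, ∃ P : MvPolynomial (Fin (r + 1)) F, P ≠ 0 ∧
      P.totalDegree ≤ d ∧ MvPolynomial.aeval (x ∘ T) P = 0)
    {v : Valuation K Γ} (hv : ∀ a : F, v (algebraMap F K a) ≤ 1)
    (hrow : ∀ i, v (∑ j, algebraMap F K (M i j) * x j ^ e j) ≤ 1) (j : Fin n) : v (x j) ≤ 1 := by
  by_contra! hj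
  obtain ⟨j₀, -, hmax⟩ := exists_max_image univ (fun j => v (x j ^ e j)) ⟨j, mem_univ j⟩
  set w := v (x j₀ ^ e j₀) with hw
  have hw1 : 1 < w := calc
    1 < v (x j) ^ e j := one_lt_pow₀ hj (Nat.ne_zero_of_lt (hd j))
    _ = v (x j ^ e j) := (map_pow v _ _).symm
    _ ≤ w := hmax j (mem_univ j)
  have hcard : k < #{j | v (x j ^ e j) = w} :=
    hM.lt_card_filter_valuation_eq hkn hv (zero_lt_one.trans hw1).ne' (fun j => hmax j (mem_univ j))
      hw.symm fun i => (hrow i).trans_lt hw1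
  obtain ⟨S, hS, hScard⟩ := exists_subset_card_eq (Nat.succ_le_of_lt (hr.trans_lt hcard))
  let T : Fin (r + 1) ↪ Fin n := (S.orderEmbOfFin hScard).toEmbedding
  have hT (i : Fin (r + 1)) : v ((x ∘ T) i) ^ e (T i) = w := by
    rw [← map_pow]
    exact (mem_filter.1 (hS (S.orderEmbOfFin_mem hScard i))).2
  obtain ⟨P, hP0, hPd, hP⟩ := hrel T
  exact aeval_ne_zero_of_valuation_pow_eq hv (fun i i' h => he (T.injective.ne h)) hw1 hT hP0
    (fun i => hPd.trans_lt (hd _)) hP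

theorem IsRegularMatrix.isIntegral (hM : IsRegularMatrix k M) (hkn : k ≤ n) (hr : r ≤ k)
    {e : Fin n → ℕ} (hd : ∀ j, d < e j) (he : Pairwise fun j j' => Nat.Coprime (e j) (e j'))
    {x : Fin n → K}
    (hrel : ∀ T : Fin (r + 1) ↪ Fin n, ∃ P : MvPolynomial (Fin (r + 1)) F, P ≠ 0 ∧
      P.totalDegree ≤ d ∧ MvPolynomial.aeval (x ∘ T) P = 0) (j : Fin n) :
    IsIntegral (Algebra.adjoin F
      (Set.range fun i => ∑ j, algebraMap F K (M i j) * x j ^ e j)) (x j) := by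
  set A := Algebra.adjoin F (Set.range fun i => ∑ j, algebraMap F K (M i j) * x j ^ e j)
  have hint : x j ∈ (integralClosure (Subring.closure (A.toSubring : Set K)) K).toSubring := by
    rw [← iInf_valuationSubring_superset, Subring.mem_iInf]
    rintro ⟨O, hO⟩
    have hval {y : K} (hy : y ∈ A) : O.valuation y ≤ 1 := (O.valuation_le_one_iff y).2 (hO hy)
    exact (O.valuation_le_one_iff _).1 <| hM.valuation_le_one hkn hr hd he hrel
      (fun a => hval (A.algebraMap_mem a)) (fun i => hval (Algebra.subset_adjoin ⟨i, rfl⟩)) j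
  rw [Subring.closure_eq] at hint
  exact hint

end Valuation

/-! ### Extending points along generically finite extensions -/

section Lifting

open Polynomial

section Valuation

variable {S K Γ : Type*} [CommRing S] [Field K] [LinearOrderedCommGroupWithZero Γ]
  {v : Valuation K Γ} {g : S →+* K} {I : Ideal S}

theorem exists_valuationSubring_lt_one (hI : I ≠ ⊤) (hker : RingHom.ker g ≤ I) :
    ∃ B : ValuationSubring K, (∀ s, g s ∈ B) ∧ ∀ s ∈ I, B.valuation (g s) < 1 := by
  have hJ : I.map g.rangeRestrict ≠ ⊤ := by
    intro htop
    have hone : g.rangeRestrict 1 ∈ I.map g.rangeRestrict := by rw [htop]; trivial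
    obtain ⟨t, ht, ht1⟩ := (Ideal.mem_map_iff_of_surjective _ g.rangeRestrict_surjective).1 hone
    have hmem : t - 1 ∈ I := hker (by
      rw [RingHom.mem_ker, map_sub, sub_eq_zero]
      exact congrArg Subtype.val ht1)
    exact hI ((Ideal.eq_top_iff_one I).2 (by simpa using I.sub_mem ht hmem))
  obtain ⟨B, hgB, hIB⟩ := Ideal.image_subset_nonunits_valuationSubring _ hJ
  exact ⟨B, fun s => hgB ⟨s, rfl⟩, fun s hs => B.mem_nonunits_iff.1
    (hIB ⟨g.rangeRestrict s, Ideal.mem_map_of_mem _ hs, rfl⟩)⟩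

theorem valuation_eq_one_of_notMem (hv : ∀ s, v (g s) ≤ 1) [hmax : I.IsMaximal]
    (hI : ∀ s ∈ I, v (g s) < 1) {s : S} (hs : s ∉ I) : v (g s) = 1 := by
  refine (hv s).antisymm (not_lt.1 fun hlt => ?_)
  obtain ⟨t, i, hi, hts⟩ := hmax.exists_inv hs
  have hsum : v (g t * g s + g i) < 1 := by
    refine v.map_add_lt ?_ (hI i hi)
    rw [map_mul]
    exact (mul_le_of_le_one_left' (hv t)).trans_lt hlt
  rw [← map_mul, ← map_add, hts, map_one, map_one] at hsum
  exact hsum.false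

theorem valuation_le_one_of_eval₂_eq_zero (hv : ∀ s, v (g s) ≤ 1) {p : S[X]} {x : K}
    (hx : p.eval₂ g x = 0) (hlead : v (g p.leadingCoeff) = 1) : v x ≤ 1 := by
  let : Algebra S K := g.toAlgebra
  obtain ⟨q, hq, hqx⟩ := isIntegral_leadingCoeff_smul p x hx
  have hint : IsIntegral v.integer (p.leadingCoeff • x) :=
    ⟨q.map (g.codRestrict v.integer hv), hq.map _, by rw [eval₂_map]; exact hqx⟩
  have hle := (Valuation.integer.integers v).mem_of_integral hint
  rwa [Valuation.mem_integer_iff, Algebra.smul_def, map_mul, RingHom.algebraMap_toAlgebra, hlead,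
    one_mul] at hle

end Valuation

theorem exists_isPrime_map_le {S R : Type*} [CommRing S] [CommRing R] [IsDomain R] [Algebra S R]
    (I : Ideal S) [hI : I.IsMaximal] (hker : RingHom.ker (algebraMap S R) ≤ I) {s : Set R}
    (hs : Algebra.adjoin S s = ⊤)
    (hp : ∀ x ∈ s, ∃ p : S[X], aeval x p = 0 ∧ p.leadingCoeff ∉ I) :
    ∃ q : Ideal R, q.IsPrime ∧ I.map (algebraMap S R) ≤ q := by
  let K := FractionRing R
  obtain ⟨B, hSB, hIB⟩ := exists_valuationSubring_lt_one (g := algebraMap S K) hI.ne_top (by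
    rwa [IsScalarTower.algebraMap_eq S R K,
      RingHom.ker_comp_of_injective _ (IsFractionRing.injective R K)])
  have hSB' : ∀ c, B.valuation (algebraMap S K c) ≤ 1 := fun c =>
    (B.valuation_le_one_iff _).2 (hSB c)
  have hRB : ∀ y : R, algebraMap R K y ∈ B := by
    intro y
    have hy : y ∈ Algebra.adjoin S s := by rw [hs]; trivial
    induction hy using Algebra.adjoin_induction with
    | mem x hx =>
      obtain ⟨p, hpx, hpI⟩ := hp x hx
      refine (B.valuation_le_one_iff _).1 (valuation_le_one_of_eval₂_eq_zero hSB'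
        (p := p) ?_ (valuation_eq_one_of_notMem hSB' hIB hpI))
      rw [IsScalarTower.algebraMap_eq S R K, ← hom_eval₂, ← aeval_def, hpx, map_zero]
    | algebraMap c => exact IsScalarTower.algebraMap_apply S R K c ▸ hSB c
    | add y z _ _ hy hz => rw [map_add]; exact B.add_mem _ _ hy hz
    | mul y z _ _ hy hz => rw [map_mul]; exact B.mul_mem _ _ hy hz
  refine ⟨(IsLocalRing.maximalIdeal B).comap ((algebraMap R K).codRestrict B hRB),
    Ideal.comap_isPrime _ _, Ideal.map_le_iff_le_comap.2 fun c hc => ?_⟩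
  rw [Ideal.mem_comap, Ideal.mem_comap, ValuationSubring.valuation_lt_one_iff]
  exact (congrArg B.valuation (IsScalarTower.algebraMap_apply S R K c)).symm.trans_lt (hIB c hc)

variable {F R : Type*} [Field F] [IsAlgClosed F] [CommRing R] [Algebra F R]

theorem exists_algHom_ker_eq_of_isIntegral {q : Ideal R} [q.IsPrime]
    [Algebra.IsIntegral F (R ⧸ q)] : ∃ ψ : R →ₐ[F] F, RingHom.ker ψ = q := by
  let E : F ≃ₐ[F] R ⧸ q := AlgEquiv.ofBijective (Algebra.ofId F (R ⧸ q))
    IsAlgClosed.algebraMap_bijective_of_isIntegral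
  refine ⟨E.symm.toAlgHom.comp (Ideal.Quotient.mkₐ F q), ?_⟩
  ext y
  simp [RingHom.mem_ker, Ideal.Quotient.eq_zero_iff_mem]

variable [IsDomain R]

theorem exists_algHom_extending {S : Type*} [CommRing S] [Algebra F S] [Algebra S R]
    [IsScalarTower F S R] (χ : S →ₐ[F] F) (hker : RingHom.ker (algebraMap S R) ≤ RingHom.ker χ)
    {s : Set R} (hs : Algebra.adjoin S s = ⊤)
    (hp : ∀ x ∈ s, ∃ p : S[X], aeval x p = 0 ∧ χ p.leadingCoeff ≠ 0) :
    ∃ ψ : R →ₐ[F] F, ∀ c, ψ (algebraMap S R c) = χ c := by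
  have hmax : (RingHom.ker χ).IsMaximal :=
    RingHom.ker_isMaximal_of_surjective χ fun a => ⟨algebraMap F S a, by simp⟩
  obtain ⟨q, hq, hqχ⟩ := exists_isPrime_map_le (RingHom.ker χ) hker hs hp
  have hsub : ∀ c, algebraMap S R c - algebraMap F R (χ c) ∈ q := fun c => by
    rw [IsScalarTower.algebraMap_apply F S R, ← map_sub]
    exact hqχ (Ideal.mem_map_of_mem _ (by simp [RingHom.mem_ker]))
  have hmk : (Ideal.Quotient.mk q).comp (algebraMap S R) = (algebraMap F (R ⧸ q)).comp χ :=
    RingHom.ext fun c => Ideal.Quotient.eq.2 (hsub c)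
  have hint : Algebra.IsIntegral F (R ⧸ q) := by
    refine ⟨fun y => ?_⟩
    obtain ⟨y, rfl⟩ := Ideal.Quotient.mk_surjective y
    have hy : y ∈ Algebra.adjoin S s := by rw [hs]; trivial
    induction hy using Algebra.adjoin_induction with
    | mem x hx =>
      obtain ⟨p, hpx, hpχ⟩ := hp x hx
      refine isAlgebraic_iff_isIntegral.1 ⟨p.map (χ : S →+* F), fun h0 => hpχ ?_, ?_⟩
      · simpa using congrArg (fun r => r.coeff p.natDegree) h0
      · rw [aeval_def, eval₂_map, ← hmk, ← hom_eval₂, ← aeval_def, hpx, map_zero]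
    | algebraMap c =>
      rw [← RingHom.comp_apply, hmk]
      exact isIntegral_algebraMap
    | add y z _ _ hy hz => rw [map_add]; exact hy.add hz
    | mul y z _ _ hy hz => rw [map_mul]; exact hy.mul hz
  obtain ⟨ψ, hψ⟩ := exists_algHom_ker_eq_of_isIntegral (F := F) (q := q)
  refine ⟨ψ, fun c => ?_⟩
  have hzero : ψ (algebraMap S R c - algebraMap F R (χ c)) = 0 := by
    rw [← RingHom.mem_ker, hψ]
    exact hsub c
  simpa [sub_eq_zero] using hzero

end Lifting

/-! ### Counting the points of a generic fiber -/

section Counting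

open Polynomial

theorem exists_bezout_of_separable_map {B : Type*} [CommRing B] [IsDomain B] (K : Type*) [Field K]
    [Algebra B K] [IsFractionRing B K] {h : B[X]} (hsep : (h.map (algebraMap B K)).Separable) :
    ∃ (c : B) (a b : B[X]), c ≠ 0 ∧ a * h + b * derivative h = C c := by
  obtain ⟨a, b, hab⟩ := hsep
  obtain ⟨s, hs0, hs⟩ := IsLocalization.integerNormalization_spec (nonZeroDivisors B) a
  obtain ⟨t, ht0, ht⟩ := IsLocalization.integerNormalization_spec (nonZeroDivisors B) b
  set a' := IsLocalization.integerNormalization (nonZeroDivisors B) a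
  set b' := IsLocalization.integerNormalization (nonZeroDivisors B) b
  refine ⟨s * t, C t * a', C s * b',
    mul_ne_zero (nonZeroDivisors.ne_zero hs0) (nonZeroDivisors.ne_zero ht0), ?_⟩
  apply Polynomial.map_injective _ (IsFractionRing.injective B K)
  have hs' : a'.map (algebraMap B K) = C (algebraMap B K s) * a := by
    rw [hs, Algebra.smul_def]; rfl
  have ht' : b'.map (algebraMap B K) = C (algebraMap B K t) * b := by
    rw [ht, Algebra.smul_def]; rfl
  simp only [Polynomial.map_add, Polynomial.map_mul, Polynomial.map_C, hs', ht', map_mul]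
  rw [derivative_map] at hab
  linear_combination (C (algebraMap B K s) * C (algebraMap B K t)) * hab

theorem exists_bezout_of_irreducible {B : Type*} [CommRing B] [IsDomain B] [IsIntegrallyClosed B]
    {h : B[X]} (hm : h.Monic) (hirr : Irreducible h) (hder : derivative h ≠ 0) :
    ∃ (c : B) (a b : B[X]), c ≠ 0 ∧ a * h + b * derivative h = C c := by
  apply exists_bezout_of_separable_map (FractionRing B)
  rw [separable_iff_derivative_ne_zero
    ((hm.irreducible_iff_irreducible_map_fraction_map (K := FractionRing B)).1 hirr),
    derivative_map]
  exact (Polynomial.map_ne_zero_iff (IsFractionRing.injective B _)).2 hder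

theorem card_roots_of_bezout {B F : Type*} [CommRing B] [Field F] [IsAlgClosed F] [DecidableEq F]
    (φ : B →+* F) {h a b : B[X]} {c : B} (hm : h.Monic) (hab : a * h + b * derivative h = C c)
    (hc : φ c ≠ 0) : (h.map φ).roots.toFinset.card = h.natDegree := by
  have hsep : (h.map φ).Separable := by
    refine ⟨C (φ c)⁻¹ * a.map φ, C (φ c)⁻¹ * b.map φ, ?_⟩
    have := congrArg (Polynomial.map φ) hab
    simp only [Polynomial.map_add, Polynomial.map_mul, Polynomial.map_C] at this
    rw [derivative_map, mul_assoc, mul_assoc, ← mul_add, this, ← C_mul, inv_mul_cancel₀ hc, C_1]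
  rw [Multiset.toFinset_card_of_nodup (nodup_roots hsep),
    ← (IsAlgClosed.splits (h.map φ)).natDegree_eq_card_roots, hm.natDegree_map]

variable {F B R : Type*} [Field F] [IsAlgClosed F] [CommRing B] [IsDomain B] [IsIntegrallyClosed B]
  [CommRing R] [IsDomain R] [Algebra F B] [Algebra F R] [Algebra B R] [IsScalarTower F B R]
  [FaithfulSMul B R]

theorem minpoly_eq_of_irreducible {h : B[X]} {y : R} (hm : h.Monic) (hirr : Irreducible h)
    (hy : aeval y h = 0) : minpoly B y = h :=
  have : Module.IsTorsionFree B R := inferInstance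
  have hint : IsIntegral B y := ⟨h, hm, hy⟩
  eq_of_monic_of_associated (minpoly.monic hint) hm
    ((minpoly.prime_of_isIntegrallyClosed hint).irreducible.associated_of_dvd hirr
      (minpoly.isIntegrallyClosed_dvd hint hy))

/-- The extension is along `B[X] → R`, `X ↦ y`, whose kernel is generated by `minpoly B y`. -/
theorem exists_algHom_extending_of_root {y : R} (hint : IsIntegral B y) (χ : B →ₐ[F] F) {t : F}
    (ht : (minpoly B y).eval₂ (χ : B →+* F) t = 0) {s : Set R} (hs : Algebra.adjoin B s = ⊤)
    (hp : ∀ x ∈ s, ∃ p : B[X], aeval x p = 0 ∧ χ p.leadingCoeff ≠ 0) :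
    ∃ ψ : R →ₐ[F] F, (∀ c, ψ (algebraMap B R c) = χ c) ∧ ψ y = t := by
  have : Module.IsTorsionFree B R := inferInstance
  let : Algebra B[X] R := (aeval (R := B) y).toAlgebra
  have hB : IsScalarTower B B[X] R := .of_algebraMap_eq fun c => (aeval_C y c).symm
  have : IsScalarTower F B[X] R := .of_algebraMap_eq fun c => by
    rw [IsScalarTower.algebraMap_apply F B R, IsScalarTower.algebraMap_apply B B[X] R,
      IsScalarTower.algebraMap_apply F B B[X]]
  let χ' : B[X] →ₐ[F] F := eval₂AlgHom χ t fun _ => Commute.all _ _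
  have hχ'C : ∀ c, χ' (C c) = χ c := fun c => eval₂_C _ _
  have hker : RingHom.ker (algebraMap B[X] R) ≤ RingHom.ker χ' := by
    intro q hq
    obtain ⟨w, rfl⟩ := minpoly.isIntegrallyClosed_dvd hint hq
    exact Ideal.mul_mem_right _ _ ht
  have hs' : Algebra.adjoin B[X] s = ⊤ := by
    rw [← Algebra.adjoin_adjoin_of_tower B, hs, Algebra.coe_top, Algebra.adjoin_univ]
  obtain ⟨ψ, hψ⟩ := exists_algHom_extending χ' hker hs' fun x hx => by
    obtain ⟨p, hpx, hpχ⟩ := hp x hx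
    refine ⟨p.map C, (aeval_map_algebraMap B[X] x p).trans hpx, ?_⟩
    rwa [leadingCoeff_map_of_injective C_injective, hχ'C]
  refine ⟨ψ, fun c => ?_, ?_⟩
  · rw [← hχ'C, ← hψ, C_eq_algebraMap, ← IsScalarTower.algebraMap_apply]
  · have hX : ψ (aeval y X) = eval₂ (χ : B →+* F) t X := hψ X
    simpa only [aeval_X, eval₂_X] using hX

theorem exists_algHoms_over_generic_point [Algebra.FiniteType B R] [Algebra.IsAlgebraic B R]
    {y : R} {h : B[X]} (hm : h.Monic) (hirr : Irreducible h) (hder : derivative h ≠ 0)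
    (hy : aeval y h = 0) :
    ∃ g : B, g ≠ 0 ∧ ∀ χ : B →ₐ[F] F, χ g ≠ 0 →
      ∃ s : Finset (R →ₐ[F] F), s.card = h.natDegree ∧
        ∀ ψ ∈ s, ∀ c, ψ (algebraMap B R c) = χ c := by
  classical
  have hmin : minpoly B y = h := minpoly_eq_of_irreducible hm hirr hy
  obtain ⟨c, a, b, hc, hab⟩ := exists_bezout_of_irreducible hm hirr hder
  obtain ⟨S, hS⟩ := Algebra.FiniteType.out (R := B) (A := R)
  choose p hp0 hpx using fun x : R => Algebra.IsAlgebraic.isAlgebraic (R := B) x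
  refine ⟨c * ∏ x ∈ S, (p x).leadingCoeff, mul_ne_zero hc (Finset.prod_ne_zero_iff.2
    fun x _ => leadingCoeff_ne_zero.2 (hp0 x)), fun χ hχ => ?_⟩
  rw [map_mul, map_prod] at hχ
  have hlead := Finset.prod_ne_zero_iff.1 (right_ne_zero_of_mul hχ)
  have hcard := card_roots_of_bezout (χ : B →+* F) hm hab (left_ne_zero_of_mul hχ)
  choose ψ hψχ hψy using fun (t : F) (ht : t ∈ (h.map (χ : B →+* F)).roots.toFinset) =>
    exists_algHom_extending_of_root ⟨h, hm, hy⟩ χ (t := t)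
      (by rw [hmin, ← eval_map]; exact isRoot_of_mem_roots (Multiset.mem_toFinset.1 ht)) hS
      fun x hx => ⟨p x, hpx x, hlead x hx⟩
  refine ⟨(h.map (χ : B →+* F)).roots.toFinset.attach.image fun t => ψ t.1 t.2, ?_, ?_⟩
  · rw [Finset.card_image_of_injective, Finset.card_attach, hcard]
    exact fun t t' htt' => Subtype.ext (by rw [← hψy t.1 t.2, htt', hψy t'.1 t'.2])
  · rintro _ hφ
    obtain ⟨t, -, rfl⟩ := Finset.mem_image.1 hφ
    exact hψχ t.1 t.2

end Counting

/-! ### Generic points -/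

section Generic

open MvPolynomial

variable {σ τ F : Type*} [Field F] {p q : (σ → F) → Prop}

/-- The points of affine space satisfying `p` contain a nonempty Zariski open set. -/
def HoldsGenerically (p : (σ → F) → Prop) : Prop :=
  ∃ g : MvPolynomial σ F, g ≠ 0 ∧ ∀ a, eval a g ≠ 0 → p a

theorem HoldsGenerically.mono (hp : HoldsGenerically p) (h : ∀ a, p a → q a) :
    HoldsGenerically q :=
  let ⟨g, hg, hgp⟩ := hp
  ⟨g, hg, fun a ha => h a (hgp a ha)⟩

theorem HoldsGenerically.and (hp : HoldsGenerically p) (hq : HoldsGenerically q) :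
    HoldsGenerically fun a => p a ∧ q a := by
  obtain ⟨g, hg, hgp⟩ := hp
  obtain ⟨h, hh, hhq⟩ := hq
  refine ⟨g * h, mul_ne_zero hg hh, fun a ha => ?_⟩
  rw [map_mul] at ha
  exact ⟨hgp a (left_ne_zero_of_mul ha), hhq a (right_ne_zero_of_mul ha)⟩

theorem holdsGenerically_eval_ne_zero {g : MvPolynomial σ F} {a : σ → F} (ha : eval a g ≠ 0) :
    HoldsGenerically fun a => eval a g ≠ 0 :=
  ⟨g, fun h0 => ha (by rw [h0, map_zero]), fun _ => id⟩

theorem eval_bind₁ (f : σ → MvPolynomial τ F) (g : MvPolynomial σ F) (a : τ → F) :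
    eval a (bind₁ f g) = eval (fun i => eval a (f i)) g := by
  simp only [← aeval_eq_eval, aeval_bind₁]

theorem holdsGenerically_eval_comp_ne_zero (f : σ → MvPolynomial τ F) {g : MvPolynomial σ F}
    {a : τ → F} (ha : eval (fun i => eval a (f i)) g ≠ 0) :
    HoldsGenerically fun a => eval (fun i => eval a (f i)) g ≠ 0 := by
  simp only [← eval_bind₁] at ha ⊢
  exact holdsGenerically_eval_ne_zero ha

theorem finite_setOf_eval_add_smul_eq_zero {g : MvPolynomial σ F} {a : σ → F} (ha : eval a g ≠ 0)
    (b : σ → F) : {t : F | eval (a + t • b) g = 0}.Finite := by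
  let Q : Polynomial F :=
    aeval (fun i => Polynomial.C (a i) + Polynomial.C (b i) * Polynomial.X) g
  have hQ : ∀ t, Q.eval t = eval (a + t • b) g := fun t => by
    rw [← Polynomial.coe_aeval_eq_eval, ← AlgHom.comp_apply, comp_aeval, ← aeval_eq_eval]
    simp [Pi.add_def, mul_comm t]
  have hQ0 : Q ≠ 0 := fun h0 => ha (by simpa [h0] using (hQ 0).symm)
  exact (Polynomial.finite_setOfPred_isRoot hQ0).subset fun t ht => (hQ t).trans ht

variable [Infinite F]

theorem exists_eval_ne_zero {g : MvPolynomial σ F} (hg : g ≠ 0) : ∃ a : σ → F, eval a g ≠ 0 := by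
  by_contra! hzero
  exact hg (MvPolynomial.funext fun a => by rw [hzero a, map_zero])

theorem HoldsGenerically.exists (hp : HoldsGenerically p) : ∃ a, p a :=
  let ⟨_, hg, hgp⟩ := hp
  let ⟨a, ha⟩ := exists_eval_ne_zero hg
  ⟨a, hgp a ha⟩

theorem HoldsGenerically.comp (hp : HoldsGenerically p) (f : σ → MvPolynomial τ F)
    (hf : Function.Surjective fun a i => eval a (f i)) :
    HoldsGenerically fun a => p fun i => eval a (f i) := by
  obtain ⟨g, hg, hgp⟩ := hp
  obtain ⟨b, hb⟩ := exists_eval_ne_zero hg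
  obtain ⟨a, rfl⟩ := hf b
  exact (holdsGenerically_eval_comp_ne_zero f hb).mono fun a ha => hgp _ ha

theorem HoldsGenerically.curry {p : (σ ⊕ τ → F) → Prop} (hp : HoldsGenerically p) :
    HoldsGenerically fun a => HoldsGenerically fun b => p (Sum.elim a b) := by
  obtain ⟨g, hg, hgp⟩ := hp
  obtain ⟨w, hw⟩ := exists_eval_ne_zero hg
  have hleft : ∀ a, eval a (bind₁ (Sum.elim X fun j => C (w (.inr j))) g) =
      eval (Sum.elim a fun j => w (.inr j)) g := fun a => by
    rw [eval_bind₁]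
    congr 2
    ext (i | j) <;> simp
  have hright : ∀ a b, eval b (bind₁ (Sum.elim (fun i => C (a i)) X) g) =
      eval (Sum.elim a b) g := fun a b => by
    rw [eval_bind₁]
    congr 2
    ext (i | j) <;> simp
  refine (holdsGenerically_eval_ne_zero (a := fun i => w (.inl i))
    (g := bind₁ (Sum.elim X fun j => C (w (.inr j))) g) ?_).mono fun a ha => ?_
  · rw [hleft]
    exact (congrArg (eval · g) (Sum.elim_comp_inl_inr w)).trans_ne hw
  · rw [hleft, ← hright] at ha
    exact (holdsGenerically_eval_ne_zero ha).mono fun b hb => hgp _ (by rwa [← hright])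

end Generic

/-! ### Shears -/

section Shear

open Polynomial

section LinearSubstitution

variable {F B ι : Type*} [Field F] [CommRing B] [Algebra F B]

theorem derivative_aeval [Fintype ι] (l : ι → B[X]) (P : MvPolynomial ι F) :
    derivative (MvPolynomial.aeval l P) =
      ∑ i, MvPolynomial.aeval l (MvPolynomial.pderiv i P) * derivative (l i) := by
  induction P using MvPolynomial.induction_on with
  | C a => simp [Polynomial.algebraMap_apply]
  | add p q hp hq => simp only [map_add, hp, hq, add_mul, Finset.sum_add_distrib]
  | mul_X p j hp =>
    classical
    have hj : ∑ i, MvPolynomial.aeval l ((Pi.single i 1 : ι → MvPolynomial ι F) j) *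
        derivative (l i) = derivative (l j) := by
      rw [Fintype.sum_eq_single j fun i hij => by simp [hij.symm]]
      simp
    simp only [map_mul, MvPolynomial.aeval_X, derivative_mul, hp, Derivation.leibniz,
      MvPolynomial.pderiv_X, smul_eq_mul, map_add, add_mul, Finset.sum_add_distrib, mul_assoc,
      ← Finset.mul_sum, hj]
    ring

variable {l : ι → B[X]}

theorem natDegree_prod_pow_le_degree (hl : ∀ i, (l i).natDegree ≤ 1) (α : ι →₀ ℕ) :
    (α.prod fun i k => l i ^ k).natDegree ≤ α.degree :=
  (natDegree_prod_le _ _).trans (Finset.sum_le_sum fun i _ =>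
    (natDegree_pow_le_of_le (α i) (hl i)).trans (mul_one _).le)

theorem coeff_prod_pow_degree (hl : ∀ i, (l i).natDegree ≤ 1) (α : ι →₀ ℕ) :
    (α.prod fun i k => l i ^ k).coeff α.degree = α.prod fun i k => (l i).coeff 1 ^ k := by
  induction α using Finsupp.induction_linear with
  | zero => simp
  | add α β hα hβ =>
    have hpow {M : Type _} [CommMonoid M] (f : ι → M) :
        (α + β).prod (fun i k => f i ^ k) =
          α.prod (fun i k => f i ^ k) * β.prod fun i k => f i ^ k :=
      Finsupp.prod_add_index' (fun i => pow_zero _) fun i => pow_add _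
    rw [hpow, hpow, map_add, coeff_mul_add_eq_of_natDegree_le (natDegree_prod_pow_le_degree hl α)
      (natDegree_prod_pow_le_degree hl β), hα, hβ]
  | single i k => simpa using coeff_pow_of_natDegree_le (m := k) (hl i)

theorem aeval_eq_sum_C_mul_prod (l : ι → B[X]) (P : MvPolynomial ι F) :
    MvPolynomial.aeval l P =
      ∑ α ∈ P.support, C (algebraMap F B (P.coeff α)) * α.prod fun i k => l i ^ k := by
  conv_lhs => rw [← MvPolynomial.support_sum_monomial_coeff P]
  simp only [map_sum, MvPolynomial.aeval_monomial, Polynomial.algebraMap_apply]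

theorem natDegree_aeval_le_totalDegree (hl : ∀ i, (l i).natDegree ≤ 1) (P : MvPolynomial ι F) :
    (MvPolynomial.aeval l P).natDegree ≤ P.totalDegree := by
  rw [aeval_eq_sum_C_mul_prod]
  exact natDegree_sum_le_of_forall_le _ _ fun α hα => (natDegree_C_mul_le _ _).trans
    ((natDegree_prod_pow_le_degree hl α).trans (MvPolynomial.le_totalDegree hα))

theorem coeff_aeval_totalDegree (hl : ∀ i, (l i).natDegree ≤ 1) (P : MvPolynomial ι F) :
    (MvPolynomial.aeval l P).coeff P.totalDegree = MvPolynomial.aeval (fun i => (l i).coeff 1)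
      (MvPolynomial.homogeneousComponent P.totalDegree P) := by
  rw [aeval_eq_sum_C_mul_prod, finsetSum_coeff, MvPolynomial.homogeneousComponent_apply, map_sum,
    Finset.sum_filter]
  refine Finset.sum_congr rfl fun α hα => ?_
  rw [coeff_C_mul, MvPolynomial.aeval_monomial]
  split_ifs with hdeg
  · rw [← hdeg, coeff_prod_pow_degree hl]
  · rw [coeff_eq_zero_of_natDegree_lt, mul_zero]
    exact (natDegree_prod_pow_le_degree hl α).trans_lt
      (lt_of_le_of_ne (MvPolynomial.le_totalDegree hα) hdeg)

end LinearSubstitution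

variable {F : Type*} [Field F] {r : ℕ}

/-- The shear of `Fin (r + 1)`-variate polynomials by `v`: the zeroth variable becomes the
variable of univariate polynomials, and a multiple of it is subtracted from all the others. -/
def shear (v : Fin r → F) : Fin (r + 1) → (MvPolynomial (Fin r) F)[X] :=
  Fin.cons X fun i => C (MvPolynomial.X i) - C (MvPolynomial.C (v i)) * X

/-- The shear by `v` as an isomorphism of algebras. -/
def shearEquiv (v : Fin r → F) :
    MvPolynomial (Fin (r + 1)) F ≃ₐ[F] (MvPolynomial (Fin r) F)[X] :=
  AlgEquiv.ofAlgHom (MvPolynomial.aeval (shear v))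
    (eval₂AlgHom (MvPolynomial.aeval fun i => MvPolynomial.X i.succ +
      MvPolynomial.C (v i) * MvPolynomial.X 0) (MvPolynomial.X 0) fun _ => Commute.all _ _)
    (by ext <;> simp [shear, MvPolynomial.algHom_C, Polynomial.algebraMap_apply])
    (by
      ext i : 1
      refine Fin.cases ?_ (fun i => ?_) i <;> simp [shear])

theorem shearEquiv_apply (v : Fin r → F) (P : MvPolynomial (Fin (r + 1)) F) :
    shearEquiv v P = MvPolynomial.aeval (shear v) P := rfl

theorem natDegree_shear_le (v : Fin r → F) (i : Fin (r + 1)) : (shear v i).natDegree ≤ 1 := by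
  refine Fin.cases ?_ (fun i => ?_) i
  · simp [shear]
  · simp only [shear, Fin.cons_succ]
    compute_degree

theorem coeff_one_shear (v : Fin r → F) (i : Fin (r + 1)) :
    (shear v i).coeff 1 = MvPolynomial.C ((Fin.cons 1 (-v) : Fin (r + 1) → F) i) := by
  refine Fin.cases ?_ (fun i => ?_) i
  · simp [shear]
  · simp [shear, coeff_C]

theorem coeff_shearEquiv_totalDegree (v : Fin r → F) (P : MvPolynomial (Fin (r + 1)) F) :
    (shearEquiv v P).coeff P.totalDegree = MvPolynomial.C (MvPolynomial.eval
      (Fin.cons 1 (-v) : Fin (r + 1) → F)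
      (MvPolynomial.homogeneousComponent P.totalDegree P)) := by
  rw [shearEquiv_apply, coeff_aeval_totalDegree (natDegree_shear_le v)]
  simp only [coeff_one_shear]
  exact MvPolynomial.aeval_algebraMap_apply _ _ _

theorem derivative_shearEquiv (v : Fin r → F) (P : MvPolynomial (Fin (r + 1)) F) :
    derivative (shearEquiv v P) = shearEquiv v (MvPolynomial.pderiv 0 P -
      ∑ i, MvPolynomial.C (v i) * MvPolynomial.pderiv i.succ P) := by
  simp only [shearEquiv_apply, derivative_aeval, Fin.sum_univ_succ, map_sub, map_sum, map_mul,
    MvPolynomial.algHom_C]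
  have hzero : derivative (shear v 0) = 1 := by simp [shear]
  have hsucc : ∀ i, derivative (shear v (Fin.succ i)) = -algebraMap F _ (v i) := fun i => by
    simp [shear, Polynomial.algebraMap_apply]
  simp only [hzero, hsucc, mul_one, mul_neg, Finset.sum_neg_distrib, sub_eq_add_neg,
    mul_comm (algebraMap F _ _)]

theorem eval₂_shearEquiv {R : Type*} [CommRing R] [Algebra F R] (v : Fin r → F)
    (y : Fin (r + 1) → R) (P : MvPolynomial (Fin (r + 1)) F) :
    eval₂ (MvPolynomial.aeval fun i => y i.succ + algebraMap F R (v i) * y 0 :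
      MvPolynomial (Fin r) F →ₐ[F] R).toRingHom (y 0) (shearEquiv v P) =
      MvPolynomial.aeval y P := by
  let z : Fin r → R := fun i => y i.succ + algebraMap F R (v i) * y 0
  suffices h : ((eval₂AlgHom (MvPolynomial.aeval z) (y 0) fun _ => Commute.all _ _).comp
      (shearEquiv v).toAlgHom : MvPolynomial (Fin (r + 1)) F →ₐ[F] R) = MvPolynomial.aeval y from
    DFunLike.congr_fun h P
  ext i : 1
  refine Fin.cases ?_ (fun i => ?_) i <;>
  simp [shearEquiv_apply, shear, z]

end Shear

/-! ### Relations between generic linear forms -/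

section Relations

open MvPolynomial

variable {F R ι : Type*} [Field F]

theorem eval_smul_of_isHomogeneous {δ : ℕ} {φ : MvPolynomial ι F} (hφ : φ.IsHomogeneous δ)
    (t : F) (a : ι → F) : eval (t • a) φ = t ^ δ * eval a φ := by
  rw [eval_eq, eval_eq, Finset.mul_sum]
  refine Finset.sum_congr rfl fun α hα => ?_
  have hdeg : ∑ i ∈ α.support, α i = δ := by
    rw [← Finsupp.degree_apply, Finsupp.degree_eq_weight_one]
    exact hφ (mem_support_iff.1 hα)
  simp only [Pi.smul_apply, smul_eq_mul, mul_pow, Finset.prod_mul_distrib,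
    Finset.prod_pow_eq_pow_sum, hdeg, mul_left_comm]

theorem homogeneousComponent_totalDegree_ne_zero {P : MvPolynomial ι F} (hP : P ≠ 0) :
    homogeneousComponent P.totalDegree P ≠ 0 := by
  obtain ⟨σ, hσ, hdeg⟩ := Finset.exists_mem_eq_sup P.support (by simpa using hP)
    (fun s => s.sum fun _ e => e)
  refine ne_zero_iff.2 ⟨σ, ?_⟩
  rw [coeff_homogeneousComponent]
  exact (if_pos hdeg.symm).trans_ne (mem_support_iff.1 hσ)

theorem pderiv_ne_zero_of_mem_support {P : MvPolynomial ι F} {σ : ι →₀ ℕ} (hσ : σ ∈ P.support)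
    {i : ι} (hi : (σ i : F) ≠ 0) : pderiv i P ≠ 0 := by
  have hpos : 0 < σ i := Nat.pos_of_ne_zero fun h => hi (by rw [h, Nat.cast_zero])
  have hcast : ((σ - Finsupp.single i 1 : ι →₀ ℕ) i : F) + 1 = σ i := by
    rw [Finsupp.tsub_apply, Finsupp.single_eq_same, Nat.cast_sub hpos, Nat.cast_one,
      sub_add_cancel]
  refine ne_zero_iff.2 ⟨σ - Finsupp.single i 1, ?_⟩
  rw [coeff_pderiv, tsub_add_cancel_of_le (Finsupp.single_le_iff.2 hpos), hcast]
  exact mul_ne_zero (mem_support_iff.1 hσ) hi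

variable [CommRing R] [Algebra F R] {y : ι → R} {P : MvPolynomial ι F}

/-- `P` is a nonzero polynomial of least total degree among those vanishing at `y`. -/
structure IsMinimalRelation (y : ι → R) (P : MvPolynomial ι F) : Prop where
  ne_zero : P ≠ 0
  aeval_eq_zero : aeval y P = 0
  totalDegree_le : ∀ Q : MvPolynomial ι F, Q ≠ 0 → aeval y Q = 0 → P.totalDegree ≤ Q.totalDegree

theorem exists_isMinimalRelation (h : ¬ AlgebraicIndependent F y) :
    ∃ P : MvPolynomial ι F, IsMinimalRelation y P := by
  let S := {Q : MvPolynomial ι F | Q ≠ 0 ∧ aeval y Q = 0}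
  have hS : S.Nonempty := by
    rw [algebraicIndependent_iff] at h
    push Not at h
    obtain ⟨Q, hQ, hQ0⟩ := h
    exact ⟨Q, hQ0, hQ⟩
  obtain ⟨hne, hzero⟩ := totalDegree.argminOn_mem S hS
  exact ⟨_, hne, hzero, fun Q hQ0 hQ => totalDegree.argminOn_le S ⟨hQ0, hQ⟩⟩

theorem IsMinimalRelation.algebraMap (h : IsMinimalRelation y P) (K : Type*) [CommRing K]
    [Algebra F K] [Algebra R K] [IsScalarTower F R K] [FaithfulSMul R K] :
    IsMinimalRelation (fun i => algebraMap R K (y i)) P where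
  ne_zero := h.ne_zero
  aeval_eq_zero := (aeval_algebraMap_apply K y P).trans (by rw [h.aeval_eq_zero, map_zero])
  totalDegree_le Q hQ0 hQ := h.totalDegree_le Q hQ0 <| FaithfulSMul.algebraMap_injective R K <|
    (aeval_algebraMap_apply K y Q).symm.trans (hQ.trans (map_zero _).symm)

variable [IsDomain R]

theorem IsMinimalRelation.irreducible (h : IsMinimalRelation y P) : Irreducible P :=
  have h' := h.algebraMap (FractionRing R)
  irreducible_of_forall_totalDegree_le h'.totalDegree_le h'.ne_zero h'.aeval_eq_zero

theorem linearIndependent_pow_expChar {K : Type*} [Field K] [Algebra F K] [PerfectField F]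
    (p : ℕ) [ExpChar F p] {s : Set K} (hs : LinearIndepOn F id s) :
    LinearIndepOn F (fun z : K => z ^ p) s := by
  have : ExpChar K p := expChar_of_injective_algebraMap (algebraMap F K).injective p
  refine LinearIndependent.map_of_injective_injective hs (frobeniusEquiv F p).symm
    (frobenius K p).toAddMonoidHom (by simp) (by simp) fun c m => ?_
  change (_ • m) ^ p = c • m ^ p
  rw [Algebra.smul_def, mul_pow, ← map_pow, frobeniusEquiv_symm_pow_p, ← Algebra.smul_def]

theorem IsMinimalRelation.exists_mem_support_cast_ne_zero [PerfectField F]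
    (h : IsMinimalRelation y P) : ∃ i, ∃ σ ∈ P.support, (σ i : F) ≠ 0 := by
  obtain hchar | ⟨p, hp, hpF⟩ := CharP.exists' F
  · by_contra! hzero
    have hC : P = C (coeff 0 P) := totalDegree_eq_zero_iff_eq_C.1 <|
      (totalDegree_eq_zero_iff _ _).2 fun σ hσ i => by exact_mod_cast hzero i σ hσ
    have hcoeff : coeff 0 P = 0 := FaithfulSMul.algebraMap_injective F R <| by
      rw [map_zero, ← h.aeval_eq_zero, hC, aeval_C, coeff_zero_C]
    exact h.ne_zero (by rw [hC, hcoeff, map_zero])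
  · have : ExpChar F p := .prime hp.out
    have h' := h.algebraMap (FractionRing R)
    obtain ⟨i, σ, hσ, hi⟩ := exists_mem_support_not_dvd_of_forall_totalDegree_le p hp.out
      (fun _ => linearIndependent_pow_expChar p) h'.totalDegree_le h'.ne_zero h'.aeval_eq_zero
    exact ⟨i, σ, hσ, by rwa [Ne, CharP.cast_eq_zero_iff F p]⟩

theorem IsMinimalRelation.exists_pderiv_ne_zero [PerfectField F] (h : IsMinimalRelation y P) :
    ∃ i, pderiv i P ≠ 0 :=
  let ⟨i, _, hσ, hi⟩ := h.exists_mem_support_cast_ne_zero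
  ⟨i, pderiv_ne_zero_of_mem_support hσ hi⟩

end Relations

section GenericRelations

open MvPolynomial

variable {F : Type*} [Field F] [Infinite F] {r : ℕ}

theorem holdsGenerically_eval_cons_ne_zero {δ : ℕ} {φ : MvPolynomial (Fin (r + 1)) F}
    (hφ : φ.IsHomogeneous δ) (hφ0 : φ ≠ 0) :
    HoldsGenerically fun v : Fin r → F => eval (Fin.cons 1 (-v) : Fin (r + 1) → F) φ ≠ 0 := by
  let dehomogenization : MvPolynomial (Fin r) F := bind₁ (Fin.cons 1 fun i => -X i) φ
  have heval (v : Fin r → F) : eval v dehomogenization = eval (Fin.cons 1 (-v)) φ := by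
    rw [eval_bind₁]
    congr 2
    ext i
    refine Fin.cases ?_ (fun i => ?_) i <;> simp
  obtain ⟨a, ha⟩ := exists_eval_ne_zero (mul_ne_zero (X_ne_zero (0 : Fin (r + 1))) hφ0)
  rw [map_mul, eval_X] at ha
  have ha0 : a 0 ≠ 0 := left_ne_zero_of_mul ha
  have hcons : (Fin.cons 1 (-fun i => -((a 0)⁻¹ * a i.succ)) : Fin (r + 1) → F) =
      (a 0)⁻¹ • a := by
    ext i
    refine Fin.cases ?_ (fun i => ?_) i <;> simp [ha0]
  refine (holdsGenerically_eval_ne_zero (g := dehomogenization)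
    (a := fun i => -((a 0)⁻¹ * a i.succ)) ?_).mono fun v hv => by rwa [heval] at hv
  rw [heval, hcons, eval_smul_of_isHomogeneous hφ]
  exact mul_ne_zero (pow_ne_zero _ (inv_ne_zero ha0)) (right_ne_zero_of_mul ha)

theorem holdsGenerically_sub_sum_C_mul_ne_zero {q : Fin (r + 1) → MvPolynomial (Fin (r + 1)) F}
    {i : Fin (r + 1)} (hi : q i ≠ 0) :
    HoldsGenerically fun v : Fin r → F => q 0 - ∑ i, C (v i) * q i.succ ≠ 0 := by
  obtain ⟨a, ha⟩ := exists_eval_ne_zero hi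
  let g : MvPolynomial (Fin r) F := C (eval a (q 0)) - ∑ i : Fin r, X i * C (eval a (q i.succ))
  have hg (v : Fin r → F) : eval v g = eval a (q 0 - ∑ i, C (v i) * q i.succ) := by simp [g]
  suffices h : ∃ v, eval v g ≠ 0 from
    (holdsGenerically_eval_ne_zero h.choose_spec).mono fun v hv h0 =>
      hv (by rw [hg, h0, map_zero])
  by_contra! hzero
  have hq0 : eval a (q 0) = 0 := by simpa [g] using hzero 0
  refine ha (Fin.cases hq0 (fun i => ?_) i)
  simpa [g, hq0, Pi.single_apply] using hzero (Pi.single i 1)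

end GenericRelations

section RelationDegree

open MvPolynomial

variable {F R : Type*} [Field F] [CommRing R] [IsDomain R] [Algebra F R] {r : ℕ}
  {y : Fin (r + 1) → R}

theorem exists_monic_irreducible_of_isMinimalRelation {P : MvPolynomial (Fin (r + 1)) F}
    (hP : IsMinimalRelation y P) {v : Fin r → F}
    (hlead : eval (Fin.cons 1 (-v) : Fin (r + 1) → F)
      (homogeneousComponent P.totalDegree P) ≠ 0)
    (hder : pderiv 0 P - ∑ i, C (v i) * pderiv i.succ P ≠ 0) :
    ∃ h : Polynomial (MvPolynomial (Fin r) F), h.Monic ∧ Irreducible h ∧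
      Polynomial.derivative h ≠ 0 ∧ h.natDegree = P.totalDegree ∧
      h.eval₂ (aeval fun i => y i.succ + algebraMap F R (v i) * y 0 :
        MvPolynomial (Fin r) F →ₐ[F] R).toRingHom (y 0) = 0 := by
  set q := eval (Fin.cons 1 (-v) : Fin (r + 1) → F) (homogeneousComponent P.totalDegree P)
  have hunit : IsUnit (Polynomial.C (C q⁻¹ : MvPolynomial (Fin r) F)) :=
    Polynomial.isUnit_C.2 ((isUnit_iff_ne_zero.2 (inv_ne_zero hlead)).map C)
  have hcoeff : (Polynomial.C (C q⁻¹) * shearEquiv v P).coeff P.totalDegree = 1 := by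
    rw [Polynomial.coeff_C_mul, coeff_shearEquiv_totalDegree, ← C_mul, inv_mul_cancel₀ hlead, C_1]
  have hdeg : (Polynomial.C (C q⁻¹) * shearEquiv v P).natDegree ≤ P.totalDegree :=
    (Polynomial.natDegree_C_mul_le _ _).trans
      (natDegree_aeval_le_totalDegree (natDegree_shear_le v) P)
  refine ⟨Polynomial.C (C q⁻¹) * shearEquiv v P,
    Polynomial.monic_of_natDegree_le_of_coeff_eq_one _ hdeg hcoeff, ?_, ?_,
    hdeg.antisymm (Polynomial.le_natDegree_of_ne_zero (hcoeff.trans_ne one_ne_zero)), ?_⟩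
  · rw [irreducible_isUnit_mul hunit]
    exact (MulEquiv.irreducible_iff (shearEquiv v)).2 hP.irreducible
  · rw [Polynomial.derivative_C_mul, derivative_shearEquiv]
    exact mul_ne_zero hunit.ne_zero ((map_ne_zero_iff _ (shearEquiv v).injective).2 hder)
  · rw [Polynomial.eval₂_mul, eval₂_shearEquiv, hP.aeval_eq_zero, mul_zero]

theorem isTranscendenceBasis_shear (htr : Algebra.trdeg F R = r)
    (hy : AlgebraicIndependent F fun i : Fin r => y i.succ) (v : Fin r → F)
    {h : Polynomial (MvPolynomial (Fin r) F)} (hm : h.Monic)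
    (hroot : h.eval₂ (aeval fun i => y i.succ + algebraMap F R (v i) * y 0 :
      MvPolynomial (Fin r) F →ₐ[F] R).toRingHom (y 0) = 0) :
    IsTranscendenceBasis F fun i : Fin r => y i.succ + algebraMap F R (v i) * y 0 := by
  set z : Fin r → R := fun i => y i.succ + algebraMap F R (v i) * y 0
  have halgMap (a : Algebra.adjoin F (Set.range z)) :
      IsAlgebraic (Algebra.adjoin F (Set.range z)) (a : R) := isAlgebraic_algebraMap a
  have hy0 : IsAlgebraic (Algebra.adjoin F (Set.range z)) (y 0) := by
    rw [Algebra.adjoin_range_eq_range_aeval]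
    refine IsIntegral.isAlgebraic ⟨h.map (aeval z).rangeRestrict.toRingHom, hm.map _, ?_⟩
    rw [Polynomial.eval₂_map]
    exact hroot
  have hysucc (i : Fin r) : IsAlgebraic (Algebra.adjoin F (Set.range z)) (y i.succ) := by
    rw [← add_sub_cancel_right (y i.succ) (algebraMap F R (v i) * y 0)]
    exact (halgMap ⟨z i, Algebra.subset_adjoin ⟨i, rfl⟩⟩).sub
      ((halgMap (algebraMap F _ (v i))).mul hy0)
  have hbasis : IsTranscendenceBasis F fun i : Fin r => y i.succ :=
    hy.isTranscendenceBasis_of_lift_trdeg_le_of_finite (by simp [htr])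
  have halg : Algebra.IsAlgebraic (Algebra.adjoin F (Set.range z)) R :=
    ⟨fun a => (hbasis.isAlgebraic.isAlgebraic a).adjoin_of_forall_isAlgebraic <| by
      rintro _ ⟨⟨i, rfl⟩, -⟩
      exact hysucc i⟩
  have : FaithfulSMul F R := (faithfulSMul_iff_algebraMap_injective F R).2 hy.algebraMap_injective
  exact Algebra.IsAlgebraic.isTranscendenceBasis_of_lift_le_trdeg_of_finite F z (by simp [htr])

theorem exists_relation_totalDegree_le [IsAlgClosed F] [Algebra.FiniteType F R] {D : ℕ}
    (htr : Algebra.trdeg F R = r) (hy : AlgebraicIndependent F fun i : Fin r => y i.succ)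
    (hD : HoldsGenerically fun v : Fin r → F => HoldsGenerically fun b : Fin r → F =>
      AlgebraicIndependent F (fun i => y i.succ + algebraMap F R (v i) * y 0) →
        ∀ s : Finset (R →ₐ[F] F),
          (∀ ψ ∈ s, ∀ i, ψ (y i.succ + algebraMap F R (v i) * y 0) = b i) → s.card ≤ D) :
    ∃ P : MvPolynomial (Fin (r + 1)) F, P ≠ 0 ∧ P.totalDegree ≤ D ∧ aeval y P = 0 := by
  have hdep : ¬ AlgebraicIndependent F y := fun h => by
    have hle := h.lift_cardinalMk_le_trdeg
    rw [htr, Cardinal.mk_fin, Cardinal.lift_natCast, Cardinal.lift_natCast, Nat.cast_le] at hle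
    omega
  obtain ⟨P, hP⟩ := exists_isMinimalRelation hdep
  obtain ⟨i, hi⟩ := hP.exists_pderiv_ne_zero
  obtain ⟨v, ⟨hlead, hder⟩, hv⟩ := (((holdsGenerically_eval_cons_ne_zero
    (homogeneousComponent_isHomogeneous P.totalDegree P)
    (homogeneousComponent_totalDegree_ne_zero hP.ne_zero)).and
    (holdsGenerically_sub_sum_C_mul_ne_zero (q := fun i => pderiv i P) hi)).and hD).exists
  obtain ⟨h, hm, hirr, hder', hdeg, hroot⟩ :=
    exists_monic_irreducible_of_isMinimalRelation hP hlead hder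
  set z : Fin r → R := fun i => y i.succ + algebraMap F R (v i) * y 0
  have hz : IsTranscendenceBasis F z := isTranscendenceBasis_shear htr hy v hm hroot
  let : Algebra (MvPolynomial (Fin r) F) R := (aeval z).toAlgebra
  have : IsScalarTower F (MvPolynomial (Fin r) F) R :=
    .of_algebraMap_eq' (aeval z).comp_algebraMap.symm
  have : FaithfulSMul (MvPolynomial (Fin r) F) R :=
    (faithfulSMul_iff_algebraMap_injective _ _).2 hz.1
  have : Algebra.IsAlgebraic (MvPolynomial (Fin r) F) R := by
    have halg := hz.isAlgebraic
    rw [Algebra.adjoin_range_eq_range_aeval] at halg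
    exact .of_ringHom_of_comp_eq (aeval z).rangeRestrict (RingHom.id R)
      (aeval z).rangeRestrict_surjective Function.injective_id rfl
  have : Algebra.FiniteType (MvPolynomial (Fin r) F) R := .of_restrictScalars_finiteType F _ _
  obtain ⟨g, hg, hcount⟩ := exists_algHoms_over_generic_point (F := F) hm hirr hder' hroot
  obtain ⟨b, hb, hbD⟩ := (HoldsGenerically.and ⟨g, hg, fun _ => id⟩ hv).exists
  obtain ⟨s, hcard, hs⟩ := hcount (aeval b) (by rwa [aeval_eq_eval])
  refine ⟨P, hP.ne_zero, ?_, hP.aeval_eq_zero⟩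
  rw [← hdeg, ← hcard]
  exact hbD hz.1 s fun ψ hψ i =>
    (congrArg ψ (aeval_X z i)).symm.trans ((hs ψ hψ (X i)).trans (aeval_X b i))

end RelationDegree

/-! ### Generic linear forms -/

section LinearForms

open MvPolynomial

variable {F R ι κ : Type*} [Field F] [CommRing R] [Algebra F R]

theorem isAlgebraic_of_not_algebraicIndependent_update [DecidableEq ι] {w : ι → R}
    (hw : AlgebraicIndependent F w) {i : ι} {a : R}
    (ha : ¬ AlgebraicIndependent F (Function.update w i a)) :
    IsAlgebraic (Algebra.adjoin F (w '' {i}ᶜ)) a := by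
  have heq : Set.EqOn (Function.update w i a) w {i}ᶜ := fun _ hj => Function.update_of_ne hj _ _
  rw [AlgebraicIndependent.iff_transcendental_adjoin_image i, heq.image_eq, Function.update_self,
    Transcendental, not_and, not_not] at ha
  refine ha ?_
  convert ((AlgebraicIndependent.iff_transcendental_adjoin_image i).1 hw).1 using 2 with j
  exact heq j.2

theorem subsingleton_setOf_not_algebraicIndependent_update [IsDomain R] [DecidableEq ι]
    {w : ι → R} (hw : AlgebraicIndependent F w) (i : ι) (u : R) :
    {t : F | ¬ AlgebraicIndependent F
      (Function.update w i (u + algebraMap F R t * w i))}.Subsingleton := by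
  intro t ht t' ht'
  by_contra hne
  let S := Algebra.adjoin F (w '' {i}ᶜ)
  have hsub : IsAlgebraic S (algebraMap F R (t - t') * w i) := by
    have h := (isAlgebraic_of_not_algebraicIndependent_update hw ht).sub
      (isAlgebraic_of_not_algebraicIndependent_update hw ht')
    rwa [add_sub_add_left_eq_sub, ← sub_mul, ← map_sub] at h
  have hinv : IsAlgebraic S (algebraMap F R (t - t')⁻¹) :=
    isAlgebraic_algebraMap (algebraMap F S (t - t')⁻¹)
  have hwi := hinv.mul hsub
  rw [← mul_assoc, ← map_mul, inv_mul_cancel₀ (sub_ne_zero.2 hne), map_one, one_mul] at hwi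
  exact ((AlgebraicIndependent.iff_transcendental_adjoin_image i).1 hw).2 hwi

theorem map_add_single_mulVec [DecidableEq ι] [DecidableEq κ] [Fintype κ] (A : Matrix ι κ F)
    (i : ι) (l : κ) (t : F) (x : κ → R) :
    ((A + Matrix.single i l t).map (algebraMap F R)).mulVec x =
      (A.map (algebraMap F R)).mulVec x + Pi.single i (algebraMap F R t * x l) := by
  rw [Matrix.map_add _ (map_add _), Matrix.add_mulVec, Matrix.map_single, Matrix.single_mulVec]
  rfl

theorem exists_algebraicIndependent_mulVec [Infinite F] [IsDomain R] [Finite ι] [Fintype κ]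
    {x : κ → R} {j : ι → κ} (hj : AlgebraicIndependent F (x ∘ j)) {p : Matrix ι κ F → Prop}
    (hp : HoldsGenerically fun a : ι × κ → F => p (Matrix.of (Function.curry a))) :
    ∃ A, p A ∧ AlgebraicIndependent F ((A.map (algebraMap F R)).mulVec x) := by
  classical
  have := Fintype.ofFinite ι
  obtain ⟨g, hg, hgp⟩ := hp
  suffices h : ∀ s : Finset ι, ∃ A : Matrix ι κ F, eval (Function.uncurry A) g ≠ 0 ∧
      AlgebraicIndependent F (s.piecewise ((A.map (algebraMap F R)).mulVec x) (x ∘ j)) by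
    obtain ⟨A, hA, hind⟩ := h Finset.univ
    exact ⟨A, hgp _ hA, by rwa [Finset.piecewise_univ] at hind⟩
  intro s
  induction s using Finset.induction_on with
  | empty =>
    obtain ⟨a, ha⟩ := exists_eval_ne_zero hg
    exact ⟨Matrix.of (Function.curry a), ha, by rwa [Finset.piecewise_empty]⟩
  | insert i s hi ih =>
    obtain ⟨A, hA, hind⟩ := ih
    obtain ⟨t, ht⟩ := ((finite_setOf_eval_add_smul_eq_zero hA (Pi.single (i, j i) 1)).union
      (subsingleton_setOf_not_algebraicIndependent_update hind i
        ((A.map (algebraMap F R)).mulVec x i)).finite).exists_notMem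
    simp only [Set.mem_union, Set.mem_ofPred_eq, not_or, not_not] at ht
    refine ⟨A + Matrix.single i (j i) t, ?_, ?_⟩
    · convert ht.1 using 3
      ext ⟨i', l⟩
      simp [Matrix.single_apply, Pi.single_apply, Prod.ext_iff, Function.uncurry, eq_comm]
    · rw [map_add_single_mulVec]
      convert ht.2 using 1
      ext i'
      rcases eq_or_ne i' i with rfl | hne
      · simp [hi]
      · simp [hne, Finset.piecewise]

theorem exists_det_ne_zero_of_linearIndependent {X : Type*} [Fintype ι] [DecidableEq ι]
    {f : ι → X → F} (hf : LinearIndependent F f) :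
    ∃ p : ι → X, (Matrix.of fun i k => f k (p i)).det ≠ 0 := by
  obtain ⟨g, hg, -, hgli⟩ := Submodule.exists_fun_fin_finrank_span_eq F (Set.range (flip f))
  choose p hp using hg
  have hcard : Fintype.card ι = Module.finrank F (Submodule.span F (Set.range (flip f))) := by
    rw [span_flip_eq_top_iff_linearIndependent.2 hf, finrank_top,
      Module.finrank_fintype_fun_eq_card]
  let E := (Fintype.equivFin ι).trans (finCongr hcard)
  refine ⟨p ∘ E, ?_⟩
  have hrow : (Matrix.of fun i k => f k (p (E i))).row = g ∘ E := funext fun i => hp (E i)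
  rw [← isUnit_iff_ne_zero, ← Matrix.isUnit_iff_isUnit_det,
    ← Matrix.linearIndependent_rows_iff_isUnit]
  exact hrow ▸ hgli.comp E E.injective

theorem holdsGenerically_linearIndependent {σ τ X : Type*} [Finite τ]
    (f : τ → X → MvPolynomial σ F) {a : σ → F}
    (ha : LinearIndependent F fun i ξ => eval a (f i ξ)) :
    HoldsGenerically fun a => LinearIndependent F fun i ξ => eval a (f i ξ) := by
  classical
  have := Fintype.ofFinite τ
  obtain ⟨p, hp⟩ := exists_det_ne_zero_of_linearIndependent ha
  have hdet : ∀ b, eval b (Matrix.of fun i k => f k (p i)).det =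
      (Matrix.of fun i k => eval b (f k (p i))).det := fun b => RingHom.map_det _ _
  refine (holdsGenerically_eval_ne_zero ((hdet a).trans_ne hp)).mono fun b hb => ?_
  rw [hdet, ← isUnit_iff_ne_zero, ← Matrix.isUnit_iff_isUnit_det,
    ← Matrix.linearIndependent_cols_iff_isUnit] at hb
  exact hb.of_comp (LinearMap.funLeft F F p)

/-- No nonzero polynomial of total degree at most `D` vanishes on all of `S`. -/
def DetectsDegreeLE {τ : Type*} (D : ℕ) (S : Set (τ → F)) : Prop :=
  ∀ P : MvPolynomial τ F, P.totalDegree ≤ D → (∀ ξ ∈ S, eval ξ P = 0) → P = 0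

theorem detectsDegreeLE_range_iff {τ X : Type*} [Finite τ] {D : ℕ} {u : X → τ → F} :
    DetectsDegreeLE D (Set.range u) ↔ LinearIndependent F fun i ξ =>
      eval (u ξ) (Module.finBasis F (restrictTotalDegree τ F D) i : MvPolynomial τ F) := by
  let b := Module.finBasis F (restrictTotalDegree τ F D)
  let L : restrictTotalDegree τ F D →ₗ[F] X → F :=
    (LinearMap.pi fun ξ => (aeval (u ξ)).toLinearMap) ∘ₗ Submodule.subtype _
  have hL : (fun i ξ => eval (u ξ) (b i : MvPolynomial τ F)) = L ∘ b := rfl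
  have hinj : DetectsDegreeLE D (Set.range u) ↔ Function.Injective L := by
    rw [injective_iff_map_eq_zero]
    simp only [DetectsDegreeLE, Set.forall_mem_range, Subtype.forall, mem_restrictTotalDegree,
      funext_iff, Submodule.mk_eq_zero]
    rfl
  rw [hL, hinj]
  refine ⟨fun h => b.linearIndependent.map' L (LinearMap.ker_eq_bot.2 h), fun h => ?_⟩
  rw [← b.constr_self F L]
  exact b.injective_constr_of_linearIndependent h

theorem holdsGenerically_detectsDegreeLE {σ τ X : Type*} [Finite τ] {D : ℕ}
    (u : X → τ → MvPolynomial σ F) {a : σ → F}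
    (ha : DetectsDegreeLE D (Set.range fun ξ i => eval a (u ξ i))) :
    HoldsGenerically fun a => DetectsDegreeLE D (Set.range fun ξ i => eval a (u ξ i)) := by
  simp only [detectsDegreeLE_range_iff, ← eval_bind₁] at ha ⊢
  exact holdsGenerically_linearIndependent _ ha

end LinearForms

/-! ### Relations between the coordinates of a variety of bounded degree -/

section CoordinateRing

open MvPolynomial

variable {F : Type u} [Field F] {n r : ℕ}

/-- The ring of polynomial functions on a set of points. -/
abbrev CoordinateRing (W : Set (Fin n → F)) : Type u :=
  MvPolynomial (Fin n) F ⧸ vanishingIdeal F W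

/-- The coordinate functions of a set of points, as elements of its coordinate ring. -/
def coord (W : Set (Fin n → F)) (j : Fin n) : CoordinateRing W :=
  Ideal.Quotient.mk _ (X j)

theorem aeval_coord (W : Set (Fin n → F)) (P : MvPolynomial (Fin n) F) :
    aeval (coord W) P = Ideal.Quotient.mk (vanishingIdeal F W) P := by
  have h : aeval (coord W) = Ideal.Quotient.mkₐ F (vanishingIdeal F W) := by
    ext i
    simp [coord]
  rw [h]
  rfl

theorem adjoin_range_coord (W : Set (Fin n → F)) :
    Algebra.adjoin F (Set.range (coord W)) = ⊤ := by
  rw [Algebra.adjoin_range_eq_range_aeval, AlgHom.range_eq_top]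
  intro f
  obtain ⟨P, rfl⟩ := Ideal.Quotient.mk_surjective f
  exact ⟨P, aeval_coord W P⟩

theorem algHom_ext_coord {W : Set (Fin n → F)} {ψ ψ' : CoordinateRing W →ₐ[F] F}
    (h : ∀ j, ψ (coord W j) = ψ' (coord W j)) : ψ = ψ' :=
  AlgHom.ext_of_adjoin_eq_top (adjoin_range_coord W) (Set.forall_mem_range.2 h)

theorem IsAffineVariety.algHom_comp_coord_mem {W : Set (Fin n → F)} (hW : IsAffineVariety W)
    (ψ : CoordinateRing W →ₐ[F] F) : ψ ∘ coord W ∈ W := by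
  suffices h : ψ ∘ coord W ∈ zeroLocus F (vanishingIdeal F W) by
    rwa [hW.zeroLocus_vanishingIdeal] at h
  intro P hP
  have hψ : aeval (ψ ∘ coord W) P = ψ (aeval (coord W) P) := by
    rw [← AlgHom.comp_apply, comp_aeval]
    rfl
  rw [hψ, aeval_coord, Ideal.Quotient.eq_zero_iff_mem.2 hP, map_zero]

theorem algHom_map_mulVec {R ι κ : Type*} [CommRing R] [Algebra F R] [Fintype κ] (ψ : R →ₐ[F] F)
    (A : Matrix ι κ F) (x : κ → R) (i : ι) :
    ψ ((A.map (algebraMap F R)).mulVec x i) = A.mulVec (ψ ∘ x) i := by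
  simp [Matrix.mulVec, dotProduct]

theorem aeval_mulVec_coord_eq_zero_iff {ι : Type*} {W : Set (Fin n → F)}
    (A : Matrix ι (Fin n) F) (P : MvPolynomial ι F) :
    aeval ((A.map (algebraMap F (CoordinateRing W))).mulVec (coord W)) P = 0 ↔
      ∀ ξ ∈ W, eval (A.mulVec ξ) P = 0 := by
  let ℓ : ι → MvPolynomial (Fin n) F := fun i => ∑ l, C (A i l) * X l
  have hℓ : ∀ i, (A.map (algebraMap F (CoordinateRing W))).mulVec (coord W) i =
      aeval (coord W) (ℓ i) := fun i => by simp [ℓ, Matrix.mulVec, dotProduct]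
  have hmk : aeval ((A.map (algebraMap F (CoordinateRing W))).mulVec (coord W)) P =
      Ideal.Quotient.mk (vanishingIdeal F W) (bind₁ ℓ P) := by
    rw [funext hℓ, ← aeval_coord, aeval_bind₁]
  rw [hmk, Ideal.Quotient.eq_zero_iff_mem, mem_vanishingIdeal_iff]
  refine forall₂_congr fun ξ _ => ?_
  rw [aeval_eq_eval, eval_bind₁]
  simp only [ℓ, map_sum, map_mul, eval_C, eval_X]
  rfl

theorem linearIndependent_row_of_algebraicIndependent {R : Type*} [CommRing R] [Algebra F R]
    {ι κ : Type*} [Fintype κ] {x : κ → R} {A : Matrix ι κ F}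
    (h : AlgebraicIndependent F ((A.map (algebraMap F R)).mulVec x)) :
    LinearIndependent F A.row := by
  have := h.algebraMap_injective.nontrivial
  refine LinearIndependent.of_comp (Fintype.linearCombination F x) ?_
  have hcomp : Fintype.linearCombination F x ∘ A.row = (A.map (algebraMap F R)).mulVec x := by
    ext i
    simp [Fintype.linearCombination_apply, Algebra.smul_def, Matrix.mulVec, dotProduct]
  exact hcomp ▸ h.linearIndependent

theorem exists_algebraicIndependent_comp_of_trdeg_eq {R κ : Type*} [CommRing R] [IsDomain R]
    [Algebra F R] [FaithfulSMul F R] {x : κ → R} (hx : Algebra.adjoin F (Set.range x) = ⊤)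
    (htr : Algebra.trdeg F R = r) :
    ∃ j : Fin r → κ, AlgebraicIndependent F (x ∘ j) := by
  have : Algebra.IsAlgebraic (Algebra.adjoin F (Set.range x)) R := by
    rw [hx]
    exact ⟨fun a => isAlgebraic_algebraMap (⟨a, trivial⟩ : (⊤ : Subalgebra F R))⟩
  obtain ⟨t, ht, htb⟩ := exists_isTranscendenceBasis_subset (R := F) (Set.range x)
  have hcard : Cardinal.mk t = r := htb.cardinalMk_eq_trdeg.trans htr
  have : Finite t := Cardinal.lt_aleph0_iff_finite.1 (hcard ▸ Cardinal.natCast_lt_aleph0)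
  let E : Fin r ≃ t :=
    (Finite.equivFinOfCardEq (by rw [Nat.card, hcard, Cardinal.toNat_natCast])).symm
  choose j hj using fun i : Fin r => ht (E i).2
  exact ⟨j, by simpa only [Function.comp_def, hj] using htb.1.comp E E.injective⟩

variable {W : Set (Fin n → F)} {D : ℕ}

theorem IsAffineVariety.card_algHom_le_of_encard_section {ι : Type*} (hW : IsAffineVariety W)
    {A : Matrix ι (Fin n) F} {b : ι → F} (hD : (W ∩ {x | A.mulVec x = b}).encard = D)
    {s : Finset (CoordinateRing W →ₐ[F] F)}
    (hs : ∀ ψ ∈ s, ∀ i, ψ ((A.map (algebraMap F _)).mulVec (coord W) i) = b i) :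
    s.card ≤ D := by
  have hmaps : Set.MapsTo (fun ψ : CoordinateRing W →ₐ[F] F => ψ ∘ coord W) s
      (W ∩ {x | A.mulVec x = b}) := by
    refine fun ψ hψ => ⟨hW.algHom_comp_coord_mem ψ, funext fun i => ?_⟩
    rw [← algHom_map_mulVec]
    exact hs ψ hψ i
  have hinj : Function.Injective fun ψ : CoordinateRing W →ₐ[F] F => (ψ ∘ coord W : Fin n → F) :=
    fun ψ ψ' h => algHom_ext_coord fun j => congrFun h j
  have hcard := Set.encard_le_encard_of_injOn hmaps hinj.injOn
  rw [hD, Set.encard_coe_eq_coe_finsetCard] at hcard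
  exact_mod_cast hcard

theorem HoldsGenerically.curry_cons [Infinite F] {κ : Type*}
    {p : Matrix (Fin (r + 1)) κ F → Prop}
    (hp : HoldsGenerically fun a : Fin (r + 1) × κ → F => p (Matrix.of (Function.curry a))) :
    HoldsGenerically fun a₀ : κ → F => HoldsGenerically fun a : Fin r × κ → F =>
      p (Matrix.of (Fin.cons a₀ (Function.curry a))) := by
  let f : Fin (r + 1) × κ → MvPolynomial (κ ⊕ Fin r × κ) F := fun q =>
    Fin.cons (α := fun _ => MvPolynomial (κ ⊕ Fin r × κ) F) (X (.inl q.2))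
      (fun i => X (.inr (i, q.2))) q.1
  have hf : ∀ a₀ a, (fun q => eval (Sum.elim a₀ a) (f q)) =
      Function.uncurry (Fin.cons (α := fun _ => κ → F) a₀ (Function.curry a)) := by
    intro a₀ a
    ext ⟨i, l⟩
    cases i using Fin.cases <;> simp [f]
  have hsurj : Function.Surjective fun a q => eval a (f q) := by
    refine fun c => ⟨Sum.elim (fun l => c (0, l)) fun q => c (q.1.succ, q.2), ?_⟩
    ext ⟨i, l⟩
    cases i using Fin.cases <;> simp [f]
  simpa only [hf, Function.curry_uncurry] using (hp.comp f hsurj).curry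

theorem holdsGenerically_detectsDegreeLE_mulVec {m : ℕ} {M : Matrix (Fin m) (Fin n) F}
    (hM : DetectsDegreeLE D (Set.range fun ξ : W => M.mulVec ξ.1)) :
    HoldsGenerically fun a : Fin m × Fin n → F =>
      DetectsDegreeLE D (Set.range fun ξ : W => (Matrix.of (Function.curry a)).mulVec ξ.1) := by
  let f : W → Fin m → MvPolynomial (Fin m × Fin n) F := fun ξ i => ∑ l, X (i, l) * C (ξ.1 l)
  have hf : ∀ a, (fun ξ i => eval a (f ξ i)) =
      fun ξ : W => (Matrix.of (Function.curry a)).mulVec ξ.1 := by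
    intro a
    ext ξ i
    simp [f, Matrix.mulVec, dotProduct]
  have hgen := holdsGenerically_detectsDegreeLE f (D := D) (a := Function.uncurry M) (by rwa [hf])
  simpa only [hf] using hgen

variable [IsAlgClosed F]

theorem IsIrreducibleVariety.trdeg_coordinateRing (hW : IsIrreducibleVariety W)
    (hr : dim W = r) : Algebra.trdeg F (CoordinateRing W) = r := by
  have := hW.isPrime_vanishingIdeal
  rw [dim_eq_ringKrullDim hW.1, ringKrullDim_eq_trdeg F] at hr
  exact Cardinal.toENat_eq_natCast.1 (by exact_mod_cast hr)

theorem IsIrreducibleVariety.exists_mulVec_coord_relation (hW : IsIrreducibleVariety W)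
    (hr : dim W = r)
    (hD : HoldsGenerically fun a : Fin r × Fin n → F => HoldsGenerically fun b : Fin r → F =>
      LinearIndependent F (Matrix.of (Function.curry a)).row →
        (W ∩ {x | (Matrix.of (Function.curry a)).mulVec x = b}).encard = D)
    {p : Matrix (Fin (r + 1)) (Fin n) F → Prop}
    (hp : HoldsGenerically fun a : Fin (r + 1) × Fin n → F => p (Matrix.of (Function.curry a))) :
    ∃ A, p A ∧ ∃ P : MvPolynomial (Fin (r + 1)) F, P ≠ 0 ∧ P.totalDegree ≤ D ∧
      aeval ((A.map (algebraMap F _)).mulVec (coord W)) P = 0 := by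
  have := hW.isPrime_vanishingIdeal
  have htr := hW.trdeg_coordinateRing hr
  obtain ⟨j, hj⟩ := exists_algebraicIndependent_comp_of_trdeg_eq (adjoin_range_coord W) htr
  obtain ⟨g, hg, hgD⟩ := hD
  obtain ⟨a₀, ha₀⟩ := hp.curry_cons.exists
  obtain ⟨A, ⟨hpA, hgA⟩, hind⟩ := exists_algebraicIndependent_mulVec hj
    (p := fun A => p (Matrix.of (Fin.cons a₀ A)) ∧ eval (Function.uncurry A) g ≠ 0)
    (ha₀.and ⟨g, hg, fun _ => id⟩)
  refine ⟨_, hpA, exists_relation_totalDegree_le htr hind ?_⟩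
  let B : (Fin r → F) → Matrix (Fin r) (Fin n) F := fun v => A + Matrix.vecMulVec v a₀
  have hB : ∀ v i, ((B v).map (algebraMap F (CoordinateRing W))).mulVec (coord W) i =
      (A.map (algebraMap F _)).mulVec (coord W) i + algebraMap F _ (v i) *
        ((Matrix.of (Fin.cons a₀ A)).map (algebraMap F _)).mulVec (coord W) 0 := by
    intro v i
    simp only [B, Matrix.mulVec, dotProduct, Matrix.map_apply, Matrix.add_apply,
      Matrix.vecMulVec_apply, map_add, map_mul, add_mul, Finset.sum_add_distrib, Finset.mul_sum,
      mul_assoc]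
    rfl
  have hgB : HoldsGenerically fun v => eval (Function.uncurry (B v)) g ≠ 0 := by
    have hfB : ∀ v, Function.uncurry (B v) = fun q => eval v (C (A q.1 q.2) + X q.1 * C (a₀ q.2)) :=
      fun v => by ext q; simp [B, Function.uncurry, Matrix.vecMulVec_apply]
    simp only [hfB]
    refine holdsGenerically_eval_comp_ne_zero _ (a := 0) ?_
    rw [← hfB]
    simpa [B] using hgA
  refine hgB.mono fun v hv => (hgD _ hv).mono fun b hb hBind s hs => ?_
  refine hW.1.card_algHom_le_of_encard_section (hb ?_) fun ψ hψ i => ?_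
  · exact linearIndependent_row_of_algebraicIndependent (funext (hB v) ▸ hBind)
  · exact (congrArg ψ (hB v i)).trans (hs ψ hψ i)

theorem IsIrreducibleVariety.exists_coord_relation (hW : IsIrreducibleVariety W)
    (hD : IsGenericSectionNumber W D) :
    ∃ r : ℕ, dim W = r ∧ ∀ T : Fin (r + 1) → Fin n, ∃ P : MvPolynomial (Fin (r + 1)) F,
      P ≠ 0 ∧ P.totalDegree ≤ D ∧ aeval (coord W ∘ T) P = 0 := by
  obtain ⟨r, hr, G, hG, hGD⟩ := hD
  refine ⟨r, hr, fun T => ?_⟩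
  have hsection : HoldsGenerically fun a : Fin r × Fin n → F => HoldsGenerically fun b =>
      LinearIndependent F (Matrix.of (Function.curry a)).row →
        (W ∩ {x | (Matrix.of (Function.curry a)).mulVec x = b}).encard = D :=
    HoldsGenerically.curry (p := fun c => LinearIndependent F
      (Matrix.of (Function.curry (c ∘ Sum.inl))).row → (W ∩ {x | (Matrix.of
        (Function.curry (c ∘ Sum.inl))).mulVec x = c ∘ Sum.inr}).encard = D)
      ⟨G, hG, fun c hc hli => hGD _ _ hli (by rwa [← Sum.elim_comp_inl_inr c] at hc)⟩
  by_contra! hT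
  let M : Matrix (Fin (r + 1)) (Fin n) F := (1 : Matrix (Fin n) (Fin n) F).submatrix T id
  have hM : ∀ x : Fin n → CoordinateRing W, (M.map (algebraMap F _)).mulVec x = x ∘ T := by
    intro x
    ext i
    simp [M, Matrix.mulVec, dotProduct, Matrix.one_apply, apply_ite (algebraMap F _)]
  have hvanish : ∀ {A : Matrix (Fin (r + 1)) (Fin n) F} {P : MvPolynomial (Fin (r + 1)) F},
      (∀ ξ ∈ Set.range fun ξ : W => A.mulVec ξ.1, eval ξ P = 0) ↔
        aeval ((A.map (algebraMap F _)).mulVec (coord W)) P = 0 := by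
    intro A P
    rw [aeval_mulVec_coord_eq_zero_iff, Set.forall_mem_range, Subtype.forall]
  have hdetects : DetectsDegreeLE D (Set.range fun ξ : W => M.mulVec ξ.1) := by
    intro P hPD hP
    by_contra hP0
    rw [hvanish, hM] at hP
    exact hT P hP0 hPD hP
  obtain ⟨A, hA, P, hP0, hPD, hP⟩ := hW.exists_mulVec_coord_relation hr hsection
    (p := fun A => DetectsDegreeLE D (Set.range fun ξ : W => A.mulVec ξ.1))
    (holdsGenerically_detectsDegreeLE_mulVec hdetects)
  exact hP0 (hA P hPD (hvanish.2 hP))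

end CoordinateRing

/-! ### Rank condensers -/

section Integrality

variable {A B C : Type*} [CommRing A] [CommRing B] [CommRing C]

theorem isIntegralElem_comp_of_surjective {f : A →+* B} (hf : Function.Surjective f) {g : B →+* C}
    {x : C} (hx : g.IsIntegralElem x) : (g.comp f).IsIntegralElem x := by
  obtain ⟨q, hq, hqx⟩ := hx
  obtain ⟨p, rfl, -, hp⟩ :=
    Polynomial.lifts_and_natDegree_eq_and_monic (Polynomial.map_surjective f hf q) hq
  exact ⟨p, hp, by rwa [Polynomial.eval₂_map] at hqx⟩

theorem isIntegralElem_aeval_of_isIntegral_adjoin {F ι : Type*} [Field F] [Algebra F B]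
    {y : ι → B} {x : B} (hx : IsIntegral (Algebra.adjoin F (Set.range y)) x) :
    (MvPolynomial.aeval (R := F) y).toRingHom.IsIntegralElem x := by
  rw [Algebra.adjoin_range_eq_range_aeval] at hx
  exact isIntegralElem_comp_of_surjective
    (MvPolynomial.aeval (R := F) y).rangeRestrict_surjective hx

theorem ringKrullDim_quotient_ker_eq_of_isIntegral {φ : A →+* B} (hφ : φ.IsIntegral) :
    ringKrullDim (A ⧸ RingHom.ker φ) = ringKrullDim B := by
  let _ := φ.kerLift.toAlgebra
  have : Algebra.IsIntegral (A ⧸ RingHom.ker φ) B :=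
    ⟨RingHom.IsIntegral.tower_top (Ideal.Quotient.mk _) φ.kerLift hφ⟩
  exact (ringKrullDim_eq_of_isIntegral φ.kerLift_injective).symm

end Integrality

section Condenser

open MvPolynomial

variable {F : Type u} [Field F] {n m : ℕ} {f : Fin m → MvPolynomial (Fin n) F}
  {V W : Set (Fin n → F)}

/-- The comorphism of the restriction of the polynomial map `f` to `V`: the pullback of functions
to the coordinate ring of `V`. -/
def comorphism (f : Fin m → MvPolynomial (Fin n) F) (V : Set (Fin n → F)) :
    MvPolynomial (Fin m) F →+* CoordinateRing V :=
  (Ideal.Quotient.mk (vanishingIdeal F V)).comp (bind₁ f).toRingHom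

theorem ker_comorphism (f : Fin m → MvPolynomial (Fin n) F) (V : Set (Fin n → F)) :
    RingHom.ker (comorphism f V) = vanishingIdeal F (polyMap f '' V) := by
  ext P
  simp only [RingHom.mem_ker, comorphism, RingHom.comp_apply, Ideal.Quotient.eq_zero_iff_mem,
    mem_vanishingIdeal_iff, Set.forall_mem_image, aeval_eq_eval]
  exact forall₂_congr fun ξ _ => Eq.congr_left (eval_bind₁ f P ξ)

theorem vanishingIdeal_zariskiClosure (S : Set (Fin n → F)) :
    vanishingIdeal F (zariskiClosure S) = vanishingIdeal F S :=
  zeroLocus_vanishingIdeal_galoisConnection.u_l_u_eq_u S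

/-- The coordinate ring of `V` is integral over the polynomials in `f`, that is, the restriction
of the polynomial map `f` to `V` is a finite morphism. -/
def IsIntegralOn (f : Fin m → MvPolynomial (Fin n) F) (V : Set (Fin n → F)) : Prop :=
  (comorphism f V).IsIntegral

theorem isIntegralOn_iff_coord :
    IsIntegralOn f V ↔ ∀ j, (comorphism f V).IsIntegralElem (coord V j) := by
  refine ⟨fun h j => h _, fun h x => ?_⟩
  obtain ⟨P, rfl⟩ := Ideal.Quotient.mk_surjective x
  induction P using MvPolynomial.induction_on with
  | C a => exact ⟨Polynomial.X - Polynomial.C (C a), Polynomial.monic_X_sub_C _, by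
      simp [comorphism]⟩
  | add p q hp hq => exact map_add (Ideal.Quotient.mk (vanishingIdeal F V)) p q ▸ hp.add _ hq
  | mul_X p j hp =>
    exact map_mul (Ideal.Quotient.mk (vanishingIdeal F V)) p (X j) ▸ hp.mul _ (h j)

theorem isIntegralOn_iff : IsIntegralOn f V ↔ ∀ j, ∃ p : Polynomial (MvPolynomial (Fin m) F),
    p.Monic ∧ p.eval₂ (bind₁ f).toRingHom (X j) ∈ vanishingIdeal F V := by
  refine isIntegralOn_iff_coord.trans (forall_congr' fun j => exists_congr fun p => ?_)
  rw [← Ideal.Quotient.eq_zero_iff_mem, Polynomial.hom_eval₂, comorphism]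
  rfl

theorem IsIntegralOn.finite_fiber (h : IsIntegralOn f V) (b : Fin m → F) :
    (polyMap f ⁻¹' {b} ∩ V).Finite := by
  classical
  choose p hp hpV using isIntegralOn_iff.1 h
  refine (Set.Finite.pi' fun j => ((p j).map (eval b)).roots.toFinset.finite_toSet).subset ?_
  rintro ξ ⟨rfl, hξV⟩ j
  have hcomp : (eval ξ).comp (bind₁ f).toRingHom = eval (polyMap f ξ) :=
    RingHom.ext fun P => eval_bind₁ f P ξ
  have hroot := hpV j ξ hξV
  rw [aeval_eq_eval, Polynomial.hom_eval₂, eval_X, hcomp, ← Polynomial.eval_map] at hroot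
  simpa only [Finset.mem_coe, Multiset.mem_toFinset,
    Polynomial.mem_roots ((hp j).map _).ne_zero, Polynomial.IsRoot] using hroot

variable [IsAlgClosed F]

theorem IsIntegralOn.dim_zariskiClosure_image (h : IsIntegralOn f V) (hV : IsAffineVariety V) :
    dim (zariskiClosure (polyMap f '' V)) = dim V := by
  rw [dim_eq_ringKrullDim hV, ← ringKrullDim_quotient_ker_eq_of_isIntegral h, ker_comorphism,
    dim_eq_ringKrullDim (V := zariskiClosure _) (isAffineVariety_zeroLocus _),
    vanishingIdeal_zariskiClosure]

theorem isIntegralOn_of_components (hV : IsAffineVariety V)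
    (h : ∀ W ∈ components V, IsIntegralOn f W) : IsIntegralOn f V := by
  refine isIntegralOn_iff.2 fun j => ?_
  have hfin := finite_components hV
  choose! p hp hpW using fun W hW => isIntegralOn_iff.1 (h W hW) j
  refine ⟨∏ W ∈ hfin.toFinset, p W,
    Polynomial.monic_prod_of_monic _ _ fun W hW => hp W (by simpa using hW), fun ξ hξ => ?_⟩
  obtain ⟨W, hW, hξW⟩ := exists_mem_components hV hξ
  rw [Polynomial.eval₂_finsetProd, map_prod]
  exact Finset.prod_eq_zero (by simpa using hW) (hpW W hW ξ hξW)

variable {k d : ℕ} {M : Matrix (Fin m) (Fin n) F} {e : Fin n → ℕ}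

theorem IsIrreducibleVariety.isIntegralOn_diagonalPolys (hW : IsIrreducibleVariety W)
    (hM : IsRegularMatrix k M) (hkn : k ≤ n) (hd : ∀ j, d < e j)
    (he : Pairwise fun j j' => Nat.Coprime (e j) (e j')) (hdim : dim W ≤ k)
    (hdeg : irreducibleDegree W ≤ d) : IsIntegralOn (diagonalPolys M e) W := by
  have := hW.isPrime_vanishingIdeal
  obtain ⟨D, hDd, hD⟩ := exists_isGenericSectionNumber_le hdeg
  obtain ⟨r, hr, hrel⟩ := hW.exists_coord_relation hD
  have hrk : r ≤ k := by exact_mod_cast hr ▸ hdim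
  let ι := algebraMap (CoordinateRing W) (FractionRing (CoordinateRing W))
  have hι : Function.Injective ι := IsFractionRing.injective _ _
  let y : Fin m → FractionRing (CoordinateRing W) :=
    fun i => ∑ j, algebraMap F _ (M i j) * ι (coord W j) ^ e j
  have hC : ∀ a : F, ι (Ideal.Quotient.mk _ (C a)) =
      algebraMap F (FractionRing (CoordinateRing W)) a :=
    fun a => (IsScalarTower.algebraMap_apply F (CoordinateRing W) _ a).symm
  have hy : ι.comp (comorphism (diagonalPolys M e) W) = (aeval (R := F) y).toRingHom := by
    ext i
    · simp [comorphism, hC]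
    · simp [comorphism, diagonalPolys, y, coord, hC]
  refine isIntegralOn_iff_coord.2 fun j => RingHom.IsIntegralElem.of_map hι ?_
  rw [hy]
  have hrel' : ∀ T : Fin (r + 1) ↪ Fin n, ∃ P : MvPolynomial (Fin (r + 1)) F, P ≠ 0 ∧
      P.totalDegree ≤ d ∧ aeval ((ι ∘ coord W) ∘ T) P = 0 := by
    intro T
    obtain ⟨P, hP0, hPD, hP⟩ := hrel T
    exact ⟨P, hP0, hPD.trans hDd, by
      rw [Function.comp_assoc, aeval_algebraMap_apply, hP, map_zero]⟩
  exact isIntegralElem_aeval_of_isIntegral_adjoin (hM.isIntegral hkn hrk hd he hrel' j)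

theorem isIntegralOn_diagonalPolys (hV : IsAffineVariety V)
    (hM : IsRegularMatrix k M) (hkn : k ≤ n) (hd : ∀ j, d < e j)
    (he : Pairwise fun j j' => Nat.Coprime (e j) (e j')) (hdim : dim V ≤ k)
    (hdeg : degree V ≤ d) : IsIntegralOn (diagonalPolys M e) V :=
  isIntegralOn_of_components hV fun _ hW => hW.1.1.isIntegralOn_diagonalPolys hM hkn hd he
    ((dim_mono hW.1.2).trans hdim) ((irreducibleDegree_le_degree hV hW).trans hdeg)

theorem isRankCondenser_diagonalPolys (hM : IsRegularMatrix k M) (hkn : k ≤ n) (hd : ∀ j, d < e j)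
    (he : Pairwise fun j j' => Nat.Coprime (e j) (e j')) :
    IsRankCondenser k d (diagonalPolys M e) := fun _ hV hdim hdeg =>
  (isIntegralOn_diagonalPolys hV hM hkn hd he hdim hdeg).dim_zariskiClosure_image hV

end Condenser

/-! ### Exponents from successive primes -/

section Primes

open Nat (nth count)

theorem nth_prime_mul_log_two_le (k : ℕ) :
    nth Nat.Prime k * Real.log 2 ≤ (k + 2) * Real.log (nth Nat.Prime k + 1) := by
  have hp : (2 : ℝ) ≤ nth Nat.Prime k := by exact_mod_cast (Nat.prime_nth_prime k).two_le
  have hpi : Nat.primeCounting (nth Nat.Prime k) = k + 1 := by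
    rw [Nat.primeCounting, Nat.primeCounting',
      Nat.count_nth_succ_of_infinite Nat.infinite_setOfPred_prime]
  have hcheb := Chebyshev.pi_ge (nth Nat.Prime k)
  rw [hpi, div_le_iff₀ (Real.log_pos (by linarith)), Nat.cast_succ] at hcheb
  have hlog : Real.log (nth Nat.Prime k) ≤ Real.log (nth Nat.Prime k + 1) :=
    Real.log_le_log (by linarith) (by linarith)
  nlinarith [mul_le_mul_of_nonneg_left hlog (Nat.cast_nonneg (α := ℝ) k)]

theorem log_le_two_mul_sqrt {x : ℝ} (hx : 0 ≤ x) : Real.log x ≤ 2 * √x := by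
  have h := Real.log_le_self (Real.sqrt_nonneg x)
  rw [Real.log_sqrt hx] at h
  linarith

theorem nth_prime_add_one_le_pow (k : ℕ) : (nth Nat.Prime k + 1 : ℝ) ≤ (k + 2) ^ 8 := by
  have hp : (2 : ℝ) ≤ nth Nat.Prime k := by exact_mod_cast (Nat.prime_nth_prime k).two_le
  set w := √((nth Nat.Prime k : ℝ) + 1)
  have hw0 : 0 < w := Real.sqrt_pos.2 (by linarith)
  have hw : w ^ 2 = nth Nat.Prime k + 1 := Real.sq_sqrt (by linarith)
  have hwk : w * w ≤ 8 * (k + 2) * w := by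
    have hlog : (k + 2) * Real.log (nth Nat.Prime k + 1) ≤ (k + 2) * (2 * w) := by
      gcongr
      exact log_le_two_mul_sqrt (by linarith)
    have hlog2 : (w ^ 2 * (2 / 3)) * 0.69 ≤ nth Nat.Prime k * Real.log 2 :=
      mul_le_mul (by linarith) (by linarith [Real.log_two_gt_d9]) (by norm_num) (by linarith)
    nlinarith [nth_prime_mul_log_two_le k]
  calc (nth Nat.Prime k + 1 : ℝ) = w ^ 2 := hw.symm
    _ ≤ (8 * (k + 2)) ^ 2 := by gcongr; exact le_of_mul_le_mul_right hwk hw0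
    _ = 2 ^ 6 * (k + 2) ^ 2 := by ring
    _ ≤ (k + 2) ^ 6 * (k + 2) ^ 2 := by gcongr; linarith [Nat.cast_nonneg (α := ℝ) k]
    _ = (k + 2) ^ 8 := by ring

theorem nth_prime_le (k : ℕ) :
    (nth Nat.Prime k : ℝ) ≤ 8 * ((k + 2) * Real.logb 2 (k + 2)) := by
  have hlog : Real.log (nth Nat.Prime k + 1) ≤ 8 * Real.log (k + 2) :=
    calc Real.log (nth Nat.Prime k + 1) ≤ Real.log ((k + 2) ^ 8) :=
          Real.log_le_log (by positivity) (nth_prime_add_one_le_pow k)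
      _ = 8 * Real.log (k + 2) := by rw [Real.log_pow, Nat.cast_ofNat]
  rw [Real.logb, ← mul_div_assoc, ← mul_div_assoc, le_div_iff₀ (Real.log_pos one_lt_two)]
  calc nth Nat.Prime k * Real.log 2 ≤ (k + 2) * Real.log (nth Nat.Prime k + 1) :=
        nth_prime_mul_log_two_le k
    _ ≤ (k + 2) * (8 * Real.log (k + 2)) := by gcongr
    _ = 8 * ((k + 2) * Real.log (k + 2)) := by ring

/-- The least prime which is at least `q`. -/
def nextPrime (q : ℕ) : ℕ := nth Nat.Prime (count Nat.Prime q)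

theorem prime_nextPrime (q : ℕ) : (nextPrime q).Prime := Nat.prime_nth_prime _

theorem le_nextPrime (q : ℕ) : q ≤ nextPrime q :=
  Nat.le_nth_count Nat.infinite_setOfPred_prime q

theorem nextPrime_le {q p : ℕ} (hp : p.Prime) (hqp : q ≤ p) : nextPrime q ≤ p :=
  (Nat.nth_monotone Nat.infinite_setOfPred_prime (Nat.count_monotone _ hqp)).trans_eq
    (Nat.nth_count hp)

/-- The number from which a search for the next prime has to start to find the `j`-th prime,
counted from `0`, which is at least `q₀`. -/
def primeSearchStart (q₀ : ℕ) : ℕ → ℕ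
  | 0 => q₀
  | j + 1 => nextPrime (primeSearchStart q₀ j) + 1

/-- The `j`-th prime, counted from `0`, which is at least `q₀`. -/
def primeFrom (q₀ j : ℕ) : ℕ := nextPrime (primeSearchStart q₀ j)

theorem prime_primeFrom (q₀ j : ℕ) : (primeFrom q₀ j).Prime := prime_nextPrime _

theorem count_primeSearchStart (q₀ j : ℕ) :
    count Nat.Prime (primeSearchStart q₀ j) = count Nat.Prime q₀ + j := by
  induction j with
  | zero => rfl
  | succ j ih =>
    rw [primeSearchStart, nextPrime,
      Nat.count_nth_succ_of_infinite Nat.infinite_setOfPred_prime, ih, add_assoc]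

theorem primeFrom_eq_nth (q₀ j : ℕ) :
    primeFrom q₀ j = nth Nat.Prime (count Nat.Prime q₀ + j) := by
  rw [primeFrom, nextPrime, count_primeSearchStart]

theorem primeFrom_injective (q₀ : ℕ) : Function.Injective (primeFrom q₀) := fun i j h => by
  rw [primeFrom_eq_nth, primeFrom_eq_nth] at h
  exact Nat.add_left_cancel (Nat.nth_injective Nat.infinite_setOfPred_prime h)

theorem le_primeSearchStart (q₀ j : ℕ) : q₀ ≤ primeSearchStart q₀ j := by
  induction j with
  | zero => rfl
  | succ j ih => exact ih.trans ((le_nextPrime _).trans (Nat.le_succ _))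

theorem le_primeFrom (q₀ j : ℕ) : q₀ ≤ primeFrom q₀ j :=
  (le_primeSearchStart q₀ j).trans (le_nextPrime _)

theorem count_prime_add_two_le (k : ℕ) : count Nat.Prime (k + 2) ≤ k :=
  (Nat.count_le_iff_le_nth Nat.infinite_setOfPred_prime).2 (Nat.add_two_le_nth_prime k)

theorem primeFrom_le {q₀ j N : ℕ} (hq₀ : 2 ≤ q₀) (h : q₀ + j ≤ N) :
    (primeFrom q₀ j : ℝ) ≤ 8 * (N * Real.logb 2 N) := by
  obtain ⟨k, rfl⟩ := Nat.exists_eq_add_of_le' hq₀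
  obtain ⟨K, rfl⟩ := Nat.exists_eq_add_of_le' (show 2 ≤ N by omega)
  have hcount : count Nat.Prime (k + 2) + j ≤ K := by
    have := count_prime_add_two_le k
    omega
  have hnth : primeFrom (k + 2) j ≤ nth Nat.Prime K :=
    primeFrom_eq_nth (k + 2) j ▸ Nat.nth_monotone Nat.infinite_setOfPred_prime hcount
  calc (primeFrom (k + 2) j : ℝ) ≤ nth Nat.Prime K := by exact_mod_cast hnth
    _ ≤ 8 * ((K + 2) * Real.logb 2 (K + 2)) := nth_prime_le K
    _ = 8 * ((K + 2 : ℕ) * Real.logb 2 (K + 2 : ℕ)) := by push_cast; rfl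

/-- The least positive power greater than `d` of the `j`-th prime which is at least `q₀`. -/
def primePowerFrom (q₀ d j : ℕ) : ℕ := primeFrom q₀ j ^ (Nat.log (primeFrom q₀ j) d + 1)

theorem lt_primePowerFrom (q₀ d j : ℕ) : d < primePowerFrom q₀ d j :=
  Nat.lt_pow_succ_log_self (prime_primeFrom q₀ j).one_lt d

theorem primePowerFrom_pos (q₀ d j : ℕ) : 0 < primePowerFrom q₀ d j :=
  (Nat.zero_le d).trans_lt (lt_primePowerFrom q₀ d j)

theorem coprime_primePowerFrom (q₀ d : ℕ) {i j : ℕ} (h : i ≠ j) :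
    Nat.Coprime (primePowerFrom q₀ d i) (primePowerFrom q₀ d j) :=
  Nat.coprime_pow_primes _ _ (prime_primeFrom q₀ i) (prime_primeFrom q₀ j)
    ((primeFrom_injective q₀).ne h)

theorem primePowerFrom_le (q₀ j : ℕ) {d : ℕ} (hd : d ≠ 0) :
    primePowerFrom q₀ d j ≤ primeFrom q₀ j * d := by
  rw [primePowerFrom, pow_succ']
  exact Nat.mul_le_mul_left _ (Nat.pow_log_le_self _ hd)

theorem primePowerFrom_of_lt {q₀ d : ℕ} (j : ℕ) (h : d < q₀) :
    primePowerFrom q₀ d j = primeFrom q₀ j := by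
  rw [primePowerFrom, Nat.log_of_lt (h.trans_le (le_primeFrom q₀ j)), zero_add, pow_one]

end Primes

/-! ### Running programs -/

section Running

/-- The program `p` transforms the state `s` into `s'`, with cost at most `T` times the cost of
handling the number `N`. -/
def Runs (N : ℕ) (p : Program) (s s' : State) (T : ℕ) : Prop :=
  ∃ t, Exec p s s' t ∧ t ≤ T * bitCost N

/-- The state in which the first registers contain the list `l` and the other ones zero, and the
list `o` has been written. -/
def listState (l o : List ℕ) : State := ⟨fun r => l.getD r 0, o⟩

variable {N : ℕ} {p q : Program} {s s' s'' : State} {T T' : ℕ} {l o : List ℕ} {dst a b r v x y : ℕ}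

theorem bitCost_mono (h : x ≤ y) : bitCost x ≤ bitCost y :=
  Nat.succ_le_succ (Nat.size_le_size h)

theorem bitCost_add_le (hx : x ≤ N) (hy : y ≤ N) : bitCost x + bitCost y ≤ 2 * bitCost N :=
  (Nat.add_le_add (bitCost_mono hx) (bitCost_mono hy)).trans_eq (two_mul _).symm

theorem listState_set (hr : r < l.length) (v : ℕ) :
    (listState l o).set r v = listState (l.set r v) o := by
  simp only [listState, State.set, State.mk.injEq, and_true]
  funext x
  by_cases hx : x = r
  · simp [List.getD_eq_getElem?_getD, hx, hr]
  · simp [List.getD_eq_getElem?_getD, hx, Ne.symm hx]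

theorem initState_eq_listState (l : List ℕ) (t : ℕ) :
    initState l = listState (l ++ List.replicate t 0) [] := by
  simp only [initState, listState, State.mk.injEq, and_true]
  funext x
  simp only [List.getD_eq_getElem?_getD, List.getElem?_append, List.getElem?_replicate]
  split_ifs <;> simp_all

namespace Runs

theorem mono (h : Runs N p s s' T) (hT : T ≤ T') : Runs N p s s' T' := by
  obtain ⟨t, hexec, ht⟩ := h
  exact ⟨t, hexec, ht.trans (Nat.mul_le_mul_right _ hT)⟩

theorem skip : Runs N .skip s s 1 :=
  ⟨1, .skip s, by simp [bitCost]⟩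

theorem const (hdst : dst < l.length := by simp) (hv : v ≤ N := by omega) :
    Runs N (.const dst v) (listState l o) (listState (l.set dst v) o) 1 :=
  ⟨_, listState_set hdst v ▸ Exec.const (listState l o) dst v, by
    simpa only [one_mul] using bitCost_mono hv⟩

theorem add (hdst : dst < l.length := by simp) (ha : l.getD a 0 ≤ N := by simp <;> omega)
    (hb : l.getD b 0 ≤ N := by simp <;> omega) :
    Runs N (.add dst a b) (listState l o)
      (listState (l.set dst (l.getD a 0 + l.getD b 0)) o) 2 :=
  ⟨_, listState_set hdst _ ▸ Exec.add (listState l o) dst a b, bitCost_add_le ha hb⟩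

theorem sub (hdst : dst < l.length := by simp) (ha : l.getD a 0 ≤ N := by simp <;> omega)
    (hb : l.getD b 0 ≤ N := by simp <;> omega) :
    Runs N (.sub dst a b) (listState l o)
      (listState (l.set dst (l.getD a 0 - l.getD b 0)) o) 2 :=
  ⟨_, listState_set hdst _ ▸ Exec.sub (listState l o) dst a b, bitCost_add_le ha hb⟩

theorem mul (hdst : dst < l.length := by simp) (ha : l.getD a 0 ≤ N := by simp <;> omega)
    (hb : l.getD b 0 ≤ N := by simp <;> omega) :
    Runs N (.mul dst a b) (listState l o)
      (listState (l.set dst (l.getD a 0 * l.getD b 0)) o) 2 :=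
  ⟨_, listState_set hdst _ ▸ Exec.mul (listState l o) dst a b, bitCost_add_le ha hb⟩

theorem mod (hdst : dst < l.length := by simp) (ha : l.getD a 0 ≤ N := by simp <;> omega)
    (hb : l.getD b 0 ≤ N := by simp <;> omega) :
    Runs N (.mod dst a b) (listState l o)
      (listState (l.set dst (l.getD a 0 % l.getD b 0)) o) 2 :=
  ⟨_, listState_set hdst _ ▸ Exec.mod (listState l o) dst a b, bitCost_add_le ha hb⟩

theorem write (ha : l.getD a 0 ≤ N := by simp <;> omega) :
    Runs N (.write a) (listState l o) (listState l (o ++ [l.getD a 0])) 1 :=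
  ⟨_, Exec.write (listState l o) a, by rw [one_mul]; exact bitCost_mono ha⟩

theorem seq (h : Runs N p s s' T) (h' : Runs N q s' s'' T') :
    Runs N (.seq p q) s s'' (T + T') := by
  obtain ⟨t, hexec, ht⟩ := h
  obtain ⟨t', hexec', ht'⟩ := h'
  exact ⟨_, .seq _ _ _ _ _ _ _ hexec hexec', by rw [add_mul]; omega⟩

theorem ifTrue (hr : l.getD r 0 ≤ N) (hr0 : l.getD r 0 ≠ 0)
    (h : Runs N p (listState l o) s' T) :
    Runs N (.ifNonzero r p q) (listState l o) s' (T + 1) := by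
  obtain ⟨t, hexec, ht⟩ := h
  have htest : bitCost ((listState l o).mem r) ≤ bitCost N := bitCost_mono hr
  exact ⟨_, .ifTrue r p q _ _ _ hr0 hexec, by rw [add_mul, one_mul]; omega⟩

theorem ifFalse (hr : l.getD r 0 = 0) (h : Runs N q (listState l o) s' T) :
    Runs N (.ifNonzero r p q) (listState l o) s' (T + 1) := by
  obtain ⟨t, hexec, ht⟩ := h
  have htest : bitCost ((listState l o).mem r) ≤ bitCost N := bitCost_mono (hr.trans_le N.zero_le)
  exact ⟨_, .ifFalse r p q _ _ _ hr hexec, by rw [add_mul, one_mul]; omega⟩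

/-- The lists `l i` and `o i` describe the state after `i` executions of the body. -/
theorem whileNonzero (K : ℕ) (l o : ℕ → List ℕ) (hr : ∀ i < K, (l i).getD r 0 ≤ N)
    (hr0 : ∀ i < K, (l i).getD r 0 ≠ 0) (hK : (l K).getD r 0 = 0)
    (hbody : ∀ i < K, Runs N p (listState (l i) (o i)) (listState (l (i + 1)) (o (i + 1))) T) :
    Runs N (.whileNonzero r p) (listState (l 0) (o 0)) (listState (l K) (o K))
      (K * (T + 1) + 1) := by
  induction K generalizing l o with
  | zero =>
    have htest : bitCost ((listState (l 0) (o 0)).mem r) ≤ bitCost N :=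
      bitCost_mono (hK.trans_le N.zero_le)
    exact ⟨_, .whileDone r p _ hK, by simpa using htest⟩
  | succ K ih =>
    obtain ⟨t, hexec, ht⟩ := hbody 0 K.succ_pos
    obtain ⟨t', hexec', ht'⟩ := ih (fun i => l (i + 1)) (fun i => o (i + 1))
      (fun i hi => hr _ (by omega)) (fun i hi => hr0 _ (by omega)) hK
      (fun i hi => hbody _ (by omega))
    have htest : bitCost ((listState (l 0) (o 0)).mem r) ≤ bitCost N :=
      bitCost_mono (hr 0 K.succ_pos)
    refine ⟨_, .whileStep r p _ _ _ _ _ (hr0 0 K.succ_pos) hexec hexec', ?_⟩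
    calc _ ≤ bitCost N + T * bitCost N + (K * (T + 1) + 1) * bitCost N := by omega
      _ = ((K + 1) * (T + 1) + 1) * bitCost N := by ring

end Runs

end Running

/-! ### The program -/

section Algorithm

infixr:60 " ;; " => Program.seq

namespace Register

-- The registers of the program, in their order. Registers from 14 on are never written to.
@[simp] abbrev cols : ℕ := 0
@[simp] abbrev rows : ℕ := 1
@[simp] abbrev bound : ℕ := 2
@[simp] abbrev start : ℕ := 3
@[simp] abbrev one : ℕ := 4
@[simp] abbrev termCount : ℕ := 5
@[simp] abbrev prime : ℕ := 6
@[simp] abbrev factor : ℕ := 7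
@[simp] abbrev counter : ℕ := 8
@[simp] abbrev row : ℕ := 9
@[simp] abbrev col : ℕ := 10
@[simp] abbrev power : ℕ := 11
@[simp] abbrev offDiagonal : ℕ := 12
@[simp] abbrev leftBlock : ℕ := 13
@[simp] abbrev zero : ℕ := 14

end Register

open Program Register

/-- Put the least prime factor of `prime` into `factor`. -/
def findFactor : Program :=
  const factor 2 ;; mod counter prime factor ;;
    whileNonzero counter (add factor factor one ;; mod counter prime factor)

/-- Increase `prime` to the next prime. -/
def searchPrime : Program :=
  findFactor ;; sub counter prime factor ;;
    whileNonzero counter (add prime prime one ;; findFactor ;; sub counter prime factor)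

/-- Put into `power` the least positive power of `prime` which is not less than `bound`. -/
def computePower : Program :=
  add power prime zero ;; sub counter bound power ;;
    whileNonzero counter (mul power power prime ;; sub counter bound power)

/-- Write `counter` zeros. -/
def writeZeros : Program :=
  whileNonzero counter (write zero ;; sub counter counter one)

/-- Write the term with coefficient `1` and with the only nonzero exponent `power`, in place
`col`. -/
def writeTerm : Program :=
  write zero ;; write one ;; add counter col zero ;; writeZeros ;; write power ;;
    sub counter cols col ;; sub counter counter one ;; writeZeros

variable {N n m D q₀ c q k r i j e u v : ℕ} {o : List ℕ}

theorem runs_findFactor (hq : 2 ≤ q) (hqN : q ≤ N) :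
    Runs N findFactor (listState [n, m, D, q₀, 1, c, q, k, r, i, j, e, u, v] o)
      (listState [n, m, D, q₀, 1, c, q, q.minFac, 0, i, j, e, u, v] o) (5 * q) := by
  have hmin : 2 ≤ q.minFac := (Nat.minFac_prime (by omega)).two_le
  have hle : q.minFac ≤ q := Nat.minFac_le (by omega)
  have hzero : q % q.minFac = 0 := Nat.mod_eq_zero_of_dvd q.minFac_dvd
  have hmod : ∀ t, q % t ≤ N := fun t => (Nat.mod_le q t).trans hqN
  have hloop := Runs.whileNonzero (N := N) (p := add factor factor one ;; mod counter prime factor)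
    (r := counter) (T := 4) (q.minFac - 2)
    (fun t => [n, m, D, q₀, 1, c, q, 2 + t, q % (2 + t), i, j, e, u, v]) (fun _ => o)
    (fun t _ => hmod _)
    (fun t ht hdvd => by
      have := Nat.minFac_le_of_dvd (by omega) (Nat.dvd_of_mod_eq_zero hdvd)
      omega)
    (by simp [Nat.add_sub_cancel' hmin, hzero])
    (fun t ht => Runs.seq Runs.add Runs.mod)
  rw [Nat.add_sub_cancel' hmin, hzero] at hloop
  exact (Runs.seq Runs.const (Runs.seq Runs.mod hloop)).mono (by omega)

theorem runs_searchPrime (hq : 2 ≤ q) (hN : nextPrime q ≤ N) :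
    Runs N searchPrime (listState [n, m, D, q₀, 1, c, q, k, r, i, j, e, u, v] o)
      (listState [n, m, D, q₀, 1, c, nextPrime q, nextPrime q, 0, i, j, e, u, v] o)
      (5 * nextPrime q * (nextPrime q + 1)) := by
  have hle := le_nextPrime q
  have hmin : ∀ t, (q + t).minFac ≤ q + t := fun t => Nat.minFac_le (by omega)
  have hnext : (nextPrime q).minFac = nextPrime q := (prime_nextPrime q).minFac_eq
  have hloop := Runs.whileNonzero (N := N)
    (p := add prime prime one ;; findFactor ;; sub counter prime factor)
    (r := counter) (T := 5 * nextPrime q + 4) (nextPrime q - q)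
    (fun t => [n, m, D, q₀, 1, c, q + t, (q + t).minFac, q + t - (q + t).minFac, i, j, e, u, v])
    (fun _ => o)
    (fun t _ => show q + t - (q + t).minFac ≤ N by omega)
    (fun t ht => show q + t - (q + t).minFac ≠ 0 from fun h => by
      have hprime : (q + t).Prime :=
        Nat.prime_def_minFac.2 ⟨by omega, (hmin t).antisymm (Nat.sub_eq_zero_iff_le.1 h)⟩
      have := nextPrime_le (q := q) hprime (by omega)
      omega)
    (by simp [Nat.add_sub_cancel' hle, hnext])
    (fun t ht => by
      have : (q + t + 1).minFac ≤ q + t + 1 := hmin (t + 1)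
      exact Runs.mono (Runs.seq Runs.add (Runs.seq (runs_findFactor (q := q + t + 1) (by omega)
        (by omega)) Runs.sub)) (by omega))
  rw [Nat.add_sub_cancel' hle, hnext, Nat.sub_self] at hloop
  have : q.minFac ≤ q := hmin 0
  refine (Runs.seq (runs_findFactor hq (by omega)) (Runs.seq Runs.sub hloop)).mono ?_
  obtain ⟨a, ha⟩ := Nat.exists_eq_add_of_le hle
  rw [ha, Nat.add_sub_cancel_left]
  nlinarith

theorem runs_computePower {d : ℕ} (hq : 2 ≤ q) (hqN : q ≤ N) (hd : d + 1 ≤ N)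
    (hN : q ^ (Nat.log q d + 1) ≤ N) :
    Runs N computePower (listState [n, m, d + 1, q₀, 1, c, q, k, r, i, j, e, u, v] o)
      (listState [n, m, d + 1, q₀, 1, c, q, k, 0, i, j, q ^ (Nat.log q d + 1), u, v] o)
      (5 * Nat.log 2 d + 5) := by
  have hend : d + 1 - q ^ (Nat.log q d + 1) = 0 :=
    Nat.sub_eq_zero_of_le (Nat.lt_pow_succ_log_self hq d)
  have hpow : ∀ t ≤ Nat.log q d, q ^ (t + 1) ≤ N := fun t ht =>
    (Nat.pow_le_pow_right (by omega) (by omega)).trans hN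
  have hloop := Runs.whileNonzero (N := N) (p := mul power power prime ;; sub counter bound power)
    (r := counter) (T := 4) (Nat.log q d)
    (fun t => [n, m, d + 1, q₀, 1, c, q, k, d + 1 - q ^ (t + 1), i, j, q ^ (t + 1), u, v])
    (fun _ => o)
    (fun t _ => show d + 1 - q ^ (t + 1) ≤ N by omega)
    (fun t ht => show d + 1 - q ^ (t + 1) ≠ 0 by
      have := Nat.pow_le_of_le_log (b := q) (x := t + 1) (y := d)
        (by rintro rfl; simp at ht) (by omega)
      omega)
    hend
    (fun t ht => by
      have := hpow t (by omega)
      have : q ^ (t + 1) * q ≤ N := hpow (t + 1) ht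
      exact Runs.seq Runs.mul Runs.sub)
  rw [hend, zero_add, pow_one] at hloop
  refine (Runs.seq Runs.add (Runs.seq Runs.sub hloop)).mono ?_
  have := Nat.log_anti_left (n := d) Nat.one_lt_two hq
  omega

theorem runs_writeZeros (hr : r ≤ N) (hN : 1 ≤ N) :
    Runs N writeZeros (listState [n, m, D, q₀, 1, c, q, k, r, i, j, e, u, v] o)
      (listState [n, m, D, q₀, 1, c, q, k, 0, i, j, e, u, v] (o ++ List.replicate r 0))
      (4 * r + 1) := by
  have hloop := Runs.whileNonzero (N := N) (p := write zero ;; sub counter counter one)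
    (r := counter) (T := 3) r
    (fun t => [n, m, D, q₀, 1, c, q, k, r - t, i, j, e, u, v])
    (fun t => o ++ List.replicate t 0)
    (fun t _ => show r - t ≤ N by omega)
    (fun t ht => show r - t ≠ 0 by omega)
    (Nat.sub_self r)
    (fun t _ => by
      rw [List.replicate_succ', ← List.append_assoc]
      exact Runs.seq Runs.write Runs.sub)
  rw [Nat.sub_self, Nat.sub_zero, List.replicate_zero, List.append_nil] at hloop
  exact hloop.mono (by omega)

/-- The encoding of the term `Xⱼ ^ e` in `n` variables. -/
def termOutput (n j e : ℕ) : List ℕ :=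
  [0, 1] ++ (List.replicate j 0 ++ ([e] ++ List.replicate (n - j - 1) 0))

theorem runs_writeTerm (hn : n ≤ N) (hj : j < n) (he : e ≤ N) :
    Runs N writeTerm (listState [n, m, D, q₀, 1, c, q, k, 0, i, j, e, u, v] o)
      (listState [n, m, D, q₀, 1, c, q, k, 0, i, j, e, u, v] (o ++ termOutput n j e))
      (4 * n + 11) := by
  have h := Runs.seq (Runs.write (N := N) (a := zero) (o := o)
      (l := [n, m, D, q₀, 1, c, q, k, 0, i, j, e, u, v]))
    (Runs.seq (Runs.write (a := one)) (Runs.seq (Runs.add (dst := counter) (a := col) (b := zero))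
    (Runs.seq (runs_writeZeros (r := j) (by omega) (by omega)) (Runs.seq (Runs.write (a := power))
    (Runs.seq (Runs.sub (dst := counter) (a := cols) (b := col))
    (Runs.seq (Runs.sub (dst := counter) (a := counter) (b := one))
    (runs_writeZeros (r := n - j - 1) (by omega) (by omega))))))))
  simp only [List.append_assoc] at h
  exact h.mono (by omega)

/-- Write the term of the column `col` in the row `row`, if there is one. -/
def writeEntry : Program :=
  sub offDiagonal row col ;; sub leftBlock col row ;; add offDiagonal offDiagonal leftBlock ;;
    sub leftBlock rows col ;;
    ifNonzero offDiagonal (ifNonzero leftBlock skip writeTerm) writeTerm ;;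
    const offDiagonal 0 ;; const leftBlock 0

/-- The output for a row `i` and a column `j`; the entry of the matrix is nonzero for `j = i` and
`m ≤ j` only. -/
def entryOutput (n m i j e : ℕ) : List ℕ :=
  if j = i ∨ m ≤ j then termOutput n j e else []

theorem runs_writeEntry (hn : n ≤ N) (hm : m ≤ n) (hi : i < m) (hj : j < n) (he : e ≤ N) :
    Runs N writeEntry (listState [n, m, D, q₀, 1, c, q, k, 0, i, j, e, 0, 0] o)
      (listState [n, m, D, q₀, 1, c, q, k, 0, i, j, e, 0, 0] (o ++ entryOutput n m i j e))
      (4 * n + 23) := by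
  have hbranch : Runs N (ifNonzero offDiagonal (ifNonzero leftBlock skip writeTerm) writeTerm)
      (listState [n, m, D, q₀, 1, c, q, k, 0, i, j, e, i - j + (j - i), m - j] o)
      (listState [n, m, D, q₀, 1, c, q, k, 0, i, j, e, i - j + (j - i), m - j]
        (o ++ entryOutput n m i j e)) (4 * n + 13) := by
    by_cases hji : j = i
    · rw [entryOutput, if_pos (.inl hji)]
      exact Runs.mono (Runs.ifFalse (show i - j + (j - i) = 0 by omega)
        (runs_writeTerm hn hj he)) (by omega)
    have htest : i - j + (j - i) ≠ 0 := by omega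
    by_cases hmj : m ≤ j
    · rw [entryOutput, if_pos (.inr hmj)]
      exact Runs.ifTrue (show i - j + (j - i) ≤ N by omega) htest
        (Runs.ifFalse (Nat.sub_eq_zero_of_le hmj) (runs_writeTerm hn hj he))
    · rw [entryOutput, if_neg (by tauto), List.append_nil]
      exact Runs.mono (Runs.ifTrue (show i - j + (j - i) ≤ N by omega) htest
        (Runs.ifTrue (show m - j ≤ N by omega) (show m - j ≠ 0 by omega) Runs.skip)) (by omega)
  exact Runs.mono (Runs.seq Runs.sub (Runs.seq Runs.sub (Runs.seq Runs.add (Runs.seq Runs.sub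
    (Runs.seq hbranch (Runs.seq Runs.const Runs.const)))))) (by omega)

/-- Treat the column `col` of the row `row`, and go to the next column. -/
def processColumn : Program :=
  searchPrime ;; computePower ;; writeEntry ;; const factor 0 ;; const power 0 ;;
    add prime prime one ;; add col col one ;; sub counter cols col

/-- An upper bound for the cost of `processColumn`, in units of the cost of handling the largest
number which occurs, for primes up to `Q`. -/
def columnCost (n d Q : ℕ) : ℕ := 5 * Q * (Q + 1) + 5 * Nat.log 2 d + 4 * n + 40

/-- The output for the row `i` and the column `j`. -/
def columnOutput (n m q₀ d i j : ℕ) : List ℕ := entryOutput n m i j (primePowerFrom q₀ d j)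

theorem runs_processColumn {d Q : ℕ} (hq₀ : 2 ≤ q₀) (hn : n ≤ N) (hm : m ≤ n) (hi : i < m)
    (hj : j < n) (hd : d + 1 ≤ N) (hQ : primeFrom q₀ j ≤ Q) (hQN : Q < N)
    (he : primePowerFrom q₀ d j ≤ N) :
    Runs N processColumn
      (listState [n, m, d + 1, q₀, 1, c, primeSearchStart q₀ j, 0, n - j, i, j, 0, 0, 0] o)
      (listState [n, m, d + 1, q₀, 1, c, primeSearchStart q₀ (j + 1), 0, n - (j + 1), i, j + 1,
        0, 0, 0] (o ++ columnOutput n m q₀ d i j))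
      (columnCost n d Q) := by
  have hq : primeFrom q₀ j < N := hQ.trans_lt hQN
  have hprime : Runs N searchPrime
      (listState [n, m, d + 1, q₀, 1, c, primeSearchStart q₀ j, 0, n - j, i, j, 0, 0, 0] o)
      (listState [n, m, d + 1, q₀, 1, c, primeFrom q₀ j, primeFrom q₀ j, 0, i, j, 0, 0, 0] o)
      (5 * Q * (Q + 1)) :=
    (runs_searchPrime (hq₀.trans (le_primeSearchStart q₀ j)) hq.le).mono
      (Nat.mul_le_mul (Nat.mul_le_mul_left 5 hQ) (Nat.succ_le_succ hQ))
  refine Runs.mono (Runs.seq hprime (Runs.seq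
    (runs_computePower (prime_primeFrom q₀ j).two_le hq.le hd he)
    (Runs.seq (runs_writeEntry hn hm hi hj he) (Runs.seq Runs.const (Runs.seq Runs.const
    (Runs.seq Runs.add (Runs.seq Runs.add Runs.sub))))))) ?_
  rw [columnCost]
  omega

/-- Write the number of terms of the row `row` and the terms, and go to the next row. -/
def processRow : Program :=
  write termCount ;; add prime start zero ;; sub counter cols col ;;
    whileNonzero counter processColumn ;;
    const col 0 ;; const prime 0 ;; add row row one ;; sub counter rows row

/-- The output for the row `i`. -/
def rowOutput (n m q₀ d i : ℕ) : List ℕ :=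
  (n - m + 1) :: (List.range n).flatMap (columnOutput n m q₀ d i)

theorem runs_processRow {d Q : ℕ} (hq₀ : 2 ≤ q₀) (hn : n < N) (hm : m ≤ n) (hi : i < m)
    (hd : d + 1 ≤ N) (hQ : ∀ j < n, primeFrom q₀ j ≤ Q) (hQN : Q < N)
    (he : ∀ j < n, primePowerFrom q₀ d j ≤ N) :
    Runs N processRow
      (listState [n, m, d + 1, q₀, 1, n - m + 1, 0, 0, m - i, i, 0, 0, 0, 0] o)
      (listState [n, m, d + 1, q₀, 1, n - m + 1, 0, 0, m - (i + 1), i + 1, 0, 0, 0, 0]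
        (o ++ rowOutput n m q₀ d i))
      (n * (columnCost n d Q + 1) + 12) := by
  have hq₀N : q₀ ≤ N := ((le_primeFrom q₀ 0).trans (hQ 0 (by omega))).trans hQN.le
  have hloop := Runs.whileNonzero (N := N) (p := processColumn) (r := counter)
    (T := columnCost n d Q) n
    (fun j => [n, m, d + 1, q₀, 1, n - m + 1, primeSearchStart q₀ j, 0, n - j, i, j, 0, 0, 0])
    (fun j => (o ++ [n - m + 1]) ++ (List.range j).flatMap (columnOutput n m q₀ d i))
    (fun j _ => show n - j ≤ N by omega)
    (fun j _ => show n - j ≠ 0 by omega)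
    (Nat.sub_self n)
    (fun j hj => by
      rw [List.range_succ, List.flatMap_append, List.flatMap_singleton, ← List.append_assoc]
      exact runs_processColumn hq₀ hn.le hm hi hj hd (hQ j hj) hQN (he j hj))
  rw [List.range_zero, List.flatMap_nil, List.append_nil, List.append_assoc, Nat.sub_self] at hloop
  exact Runs.mono (Runs.seq Runs.write (Runs.seq Runs.add (Runs.seq Runs.sub (Runs.seq hloop
    (Runs.seq Runs.const (Runs.seq Runs.const (Runs.seq Runs.add Runs.sub))))))) (by omega)

/-- The program of both constructions; `setStart` puts the lower bound for the primes into the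
register `start`. -/
def extractorProgram (setStart : Program) : Program :=
  const one 1 ;; add bound bound one ;; setStart ;; sub termCount cols rows ;;
    add termCount termCount one ;; sub counter rows row ;; whileNonzero counter processRow

/-- On the input `n`, `m`, `d`, once `d` has been increased by one, `setStart` puts `q₀` into the
register `start`. -/
def SetsStart (setStart : Program) (n m d q₀ : ℕ) : Prop :=
  ∀ N, 2 ≤ N → d + 1 ≤ N →
    Runs N setStart (listState [n, m, d + 1, 0, 1, 0, 0, 0, 0, 0, 0, 0, 0, 0] [])
      (listState [n, m, d + 1, q₀, 1, 0, 0, 0, 0, 0, 0, 0, 0, 0] []) 2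

theorem runs_extractorProgram {d Q : ℕ} {setStart : Program} (hq₀ : 2 ≤ q₀) (hn : n < N)
    (hm1 : 1 ≤ m) (hm : m ≤ n) (hd : d + 1 ≤ N) (hQ : ∀ j < n, primeFrom q₀ j ≤ Q) (hQN : Q < N)
    (he : ∀ j < n, primePowerFrom q₀ d j ≤ N) (hstart : SetsStart setStart n m d q₀) :
    Runs N (extractorProgram setStart) (initState [n, m, d])
      (listState [n, m, d + 1, q₀, 1, n - m + 1, 0, 0, 0, m, 0, 0, 0, 0]
        ((List.range m).flatMap (rowOutput n m q₀ d)))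
      (m * (n * (columnCost n d Q + 1) + 13) + 12) := by
  have hloop := Runs.whileNonzero (N := N) (p := processRow) (r := counter)
    (T := n * (columnCost n d Q + 1) + 12) m
    (fun i => [n, m, d + 1, q₀, 1, n - m + 1, 0, 0, m - i, i, 0, 0, 0, 0])
    (fun i => (List.range i).flatMap (rowOutput n m q₀ d))
    (fun i _ => show m - i ≤ N by omega)
    (fun i _ => show m - i ≠ 0 by omega)
    (Nat.sub_self m)
    (fun i hi => by
      rw [List.range_succ, List.flatMap_append, List.flatMap_singleton]
      exact runs_processRow hq₀ hn hm hi hd hQ hQN he)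
  rw [List.range_zero, List.flatMap_nil, Nat.sub_self] at hloop
  rw [initState_eq_listState _ 11]
  exact Runs.mono (Runs.seq Runs.const (Runs.seq Runs.add (Runs.seq (hstart N (by omega) hd)
    (Runs.seq Runs.sub (Runs.seq Runs.add (Runs.seq Runs.sub hloop)))))) (by linarith)

end Algorithm

/-! ### The matrices -/

section Matrices

/-- The coefficients of the construction: an identity matrix and columns of ones. -/
def onesMatrix (m n : ℕ) : Matrix (Fin m) (Fin n) ℤ :=
  fun i j => if (j : ℕ) = i ∨ m ≤ j then 1 else 0

theorem onesMatrix_eq_zero_or_one {m n : ℕ} (i : Fin m) (j : Fin n) :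
    onesMatrix m n i j = 0 ∨ onesMatrix m n i j = 1 := by
  rw [onesMatrix]
  exact (ite_eq_or_eq _ _ _).symm

theorem onesMatrix_self (n : ℕ) : onesMatrix n n = 1 := by
  ext i j
  simp [onesMatrix, Matrix.one_apply, Fin.ext_iff, eq_comm, not_le.2 j.2]

theorem onesMatrix_one_left (n : ℕ) (i : Fin 1) (j : Fin n) : onesMatrix 1 n i j = 1 :=
  if_pos (by omega)

variable {F : Type u} [Field F]

theorem map_onesMatrix_mulVec (m : ℕ) (g : Fin (m + 1) → F) (i : Fin m) :
    ((onesMatrix m (m + 1)).map (Int.castRingHom F)).mulVec g i =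
      g i.castSucc + g (Fin.last m) := by
  rw [Matrix.mulVec, dotProduct, Fin.sum_univ_castSucc, Finset.sum_eq_single i]
  · simp [onesMatrix]
  · intro l _ hl
    simp [onesMatrix, Fin.val_inj, hl]
  · simp

theorem linearIndependent_col_of_mulVec {m n : ℕ} {M : Matrix (Fin m) (Fin n) F}
    {s : Finset (Fin n)} (h : ∀ g, (∀ j ∉ s, g j = 0) → M.mulVec g = 0 → g = 0) :
    LinearIndependent F fun j : s => M.col j := by
  refine linearIndepOn_finset_iff.2 fun g hg j hj => ?_
  have hzero := h (fun l => if l ∈ s then g l else 0) (fun l hl => if_neg hl) <| by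
    rw [Matrix.mulVec_eq_sum, ← hg, ← Finset.sum_subset s.subset_univ]
    · refine Finset.sum_congr rfl fun l hl => ?_
      rw [if_pos hl]
      exact op_smul_eq_smul _ _
    · intro l _ hl
      simp [hl]
  simpa [hj] using congrFun hzero j

theorem isRegularMatrix_onesMatrix_self (n : ℕ) :
    IsRegularMatrix n ((onesMatrix n n).map (Int.castRingHom F)) := fun s _ =>
  linearIndependent_col_of_mulVec fun g _ hg => by
    rwa [onesMatrix_self, Matrix.map_one _ (map_zero _) (map_one _), Matrix.one_mulVec] at hg

theorem isRegularMatrix_onesMatrix_one (n : ℕ) :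
    IsRegularMatrix 1 ((onesMatrix 1 n).map (Int.castRingHom F)) := fun s hs => by
  obtain ⟨j, rfl⟩ := Finset.card_eq_one.1 hs
  refine linearIndependent_unique_iff.2 fun h => ?_
  simpa [onesMatrix_one_left] using congrFun h 0

theorem isRegularMatrix_onesMatrix_succ (m : ℕ) :
    IsRegularMatrix m ((onesMatrix m (m + 1)).map (Int.castRingHom F)) := fun s hs => by
  refine linearIndependent_col_of_mulVec fun g hgs hg => ?_
  have hrow : ∀ i : Fin m, g i.castSucc + g (Fin.last m) = 0 := fun i => by
    rw [← map_onesMatrix_mulVec, hg, Pi.zero_apply]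
  obtain ⟨j, hj⟩ : ∃ j, j ∉ s := by
    by_contra! h
    rw [Finset.eq_univ_of_forall h, Finset.card_univ, Fintype.card_fin] at hs
    omega
  have hlast : g (Fin.last m) = 0 := by
    cases j using Fin.lastCases with
    | last => exact hgs _ hj
    | cast i => simpa [hgs _ hj] using hrow i
  funext l
  cases l using Fin.lastCases with
  | last => exact hlast
  | cast i => simpa [hlast] using hrow i

theorem isRegularMatrix_onesMatrix {m n : ℕ} (hmn : m = 1 ∨ m + 1 = n ∨ m = n) :
    IsRegularMatrix m ((onesMatrix m n).map (Int.castRingHom F)) := by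
  rcases hmn with rfl | rfl | rfl
  · exact isRegularMatrix_onesMatrix_one n
  · exact isRegularMatrix_onesMatrix_succ m
  · exact isRegularMatrix_onesMatrix_self m

end Matrices

/-! ### The output of the program -/

section Output

open MvPolynomial

theorem map_diagonalPolys {R : Type*} {S : Type*} [CommRing R] [CommRing S] {m n : ℕ}
    (f : R →+* S) (c : Matrix (Fin m) (Fin n) R) (e : Fin n → ℕ) (i : Fin m) :
    map f (diagonalPolys c e i) = diagonalPolys (c.map f) e i := by
  simp [diagonalPolys]

variable {R : Type*} [CommRing R] {m n : ℕ} {e : Fin n → ℕ}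

theorem diagonalPolys_eq_sum_monomial (c : Matrix (Fin m) (Fin n) R) (e : Fin n → ℕ) (i : Fin m) :
    diagonalPolys c e i = ∑ j, monomial (Finsupp.single j (e j)) (c i j) :=
  Finset.sum_congr rfl fun _ _ => C_mul_X_pow_eq_monomial

theorem single_injective_of_pos (he : ∀ j, 0 < e j) :
    Function.Injective fun j => Finsupp.single j (e j) := fun j _ h =>
  ((Finsupp.single_eq_single_iff _ _ _ _).1 h).elim (fun h => h.1) fun h => absurd h.1 (he j).ne'

theorem coeff_diagonalPolys (c : Matrix (Fin m) (Fin n) R) (he : ∀ j, 0 < e j) (i : Fin m)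
    (s : Fin n →₀ ℕ) :
    coeff s (diagonalPolys c e i) = 0 ∨ ∃ j, coeff s (diagonalPolys c e i) = c i j := by
  classical
  simp only [diagonalPolys_eq_sum_monomial, coeff_sum, coeff_monomial]
  by_cases h : ∃ j, Finsupp.single j (e j) = s
  · obtain ⟨j, rfl⟩ := h
    refine .inr ⟨j, ?_⟩
    simp only [(single_injective_of_pos he).eq_iff, Finset.sum_ite_eq', Finset.mem_univ, if_true]
  · push Not at h
    exact .inl (Finset.sum_eq_zero fun j _ => if_neg (h j))

theorem totalDegree_diagonalPolys_le {D : ℕ} (c : Matrix (Fin m) (Fin n) R) (he : ∀ j, e j ≤ D)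
    (i : Fin m) : (diagonalPolys c e i).totalDegree ≤ D := by
  rw [diagonalPolys_eq_sum_monomial]
  refine totalDegree_finsetSum_le fun j _ => (totalDegree_monomial_le _ _).trans ?_
  simpa [Finsupp.sum_single_index] using he j

theorem flatMap_filter {α β : Type*} (p : α → Bool) (f : α → List β) (l : List α) :
    (l.filter p).flatMap f = l.flatMap fun x => if p x then f x else [] := by
  induction l with
  | nil => rfl
  | cons a l ih => by_cases h : p a <;> simp [h, ih]

theorem ofFn_single (j : Fin n) (a : ℕ) :
    List.ofFn (Finsupp.single j a) =
      List.replicate (j : ℕ) 0 ++ ([a] ++ List.replicate (n - j - 1) 0) := by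
  refine List.ext_getElem (by simp; omega) fun l h _ => ?_
  rw [List.getElem_ofFn]
  rcases lt_trichotomy (j : ℕ) l with hl | rfl | hl
  · rw [Finsupp.single_eq_of_ne (by simp [Fin.ext_iff]; omega), List.getElem_append_right
      (by simp; omega), List.getElem_append_right (by simp; omega), List.getElem_replicate]
  · simp
  · rw [Finsupp.single_eq_of_ne (by simp [Fin.ext_iff]; omega), List.getElem_append_left
      (by simpa using hl), List.getElem_replicate]

theorem encodeTerm_single (j : Fin n) (a : ℕ) :
    encodeTerm (Finsupp.single j a, (1 : ℤ)) = termOutput n j a := by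
  rw [encodeTerm, termOutput, ← ofFn_single]
  rfl

/-- The terms of the polynomial of the row `i` of `onesMatrix m n`, for the exponents `e`. -/
def rowTerms (m : ℕ) (e : Fin n → ℕ) (i : ℕ) : List ((Fin n →₀ ℕ) × ℤ) :=
  ((List.finRange n).filter fun j : Fin n => decide ((j : ℕ) = i ∨ m ≤ j)).map
    fun j => (Finsupp.single j (e j), 1)

theorem isSparseRep_rowTerms (he : ∀ j, 0 < e j) (i : Fin m) :
    IsSparseRep (diagonalPolys (onesMatrix m n) e i) (rowTerms m e i) := by
  have hnodup : ((List.finRange n).filter fun j : Fin n => decide ((j : ℕ) = i ∨ m ≤ j)).Nodup :=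
    (List.nodup_finRange n).filter _
  refine ⟨?_, ?_, ?_⟩
  · rw [rowTerms, List.map_map]
    exact hnodup.map (single_injective_of_pos he)
  · intro t ht
    obtain ⟨j, -, rfl⟩ := List.mem_map.1 ht
    exact one_ne_zero
  · rw [rowTerms, List.map_map, ← List.sum_toFinset _ hnodup, diagonalPolys_eq_sum_monomial,
      List.toFinset_filter, List.toFinset_finRange, Finset.sum_filter]
    refine Finset.sum_congr rfl fun j _ => ?_
    by_cases h : (j : ℕ) = i ∨ m ≤ j <;> simp [h, onesMatrix]

theorem length_rowTerms (e : Fin n → ℕ) {i : ℕ} (hi : i < m) (hm : m ≤ n) :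
    (rowTerms m e i).length = n - m + 1 := by
  have hindices : ((List.range n).filter fun j => decide (j = i ∨ m ≤ j)).toFinset =
      insert i (Finset.Ico m n) := by
    ext j
    simp only [List.mem_toFinset, List.mem_filter, List.mem_range, decide_eq_true_eq,
      Finset.mem_insert, Finset.mem_Ico]
    omega
  calc (rowTerms m e i).length
      = ((List.range n).filter fun j => decide (j = i ∨ m ≤ j)).length := by
        rw [← List.map_coe_finRange_eq_range, List.filter_map, List.length_map, rowTerms,
          List.length_map]
        rfl
    _ = (insert i (Finset.Ico m n)).card := by
        rw [← List.toFinset_card_of_nodup (List.nodup_range.filter _), hindices]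
    _ = n - m + 1 := by
        rw [Finset.card_insert_of_notMem (by simp [hi]), Nat.card_Ico]

theorem encodeTerms_rowTerms {i : ℕ} (q₀ d : ℕ) (hi : i < m) (hm : m ≤ n) :
    encodeTerms (rowTerms m (fun j : Fin n => primePowerFrom q₀ d j) i) = rowOutput n m q₀ d i := by
  rw [encodeTerms, rowOutput, length_rowTerms _ hi hm, rowTerms, List.flatMap_map,
    flatMap_filter, ← List.map_coe_finRange_eq_range, List.flatMap_map]
  simp only [decide_eq_true_eq, encodeTerm_single, columnOutput, entryOutput]

theorem isSparseEncoding_rowOutput (q₀ d : ℕ) (hm : m ≤ n) :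
    IsSparseEncoding (diagonalPolys (onesMatrix m n) fun j : Fin n => primePowerFrom q₀ d j)
      ((List.range m).flatMap (rowOutput n m q₀ d)) := by
  refine ⟨fun i => rowTerms m _ i,
    isSparseRep_rowTerms fun j => primePowerFrom_pos q₀ d j, ?_⟩
  rw [List.ofFn_eq_map, List.flatMap_map, ← List.map_coe_finRange_eq_range, List.flatMap_map]
  simp only [encodeTerms_rowTerms, Fin.is_lt, hm]

end Output

/-! ### Running time and degrees -/

section Construction

theorem bitCost_mul_le (Q d n : ℕ) :
    bitCost ((Q + 1) * (d + 1) * (n + 2)) ≤ Q + Nat.log 2 d + n + 4 := by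
  have hQ : Q + 1 ≤ 2 ^ Q := Nat.lt_two_pow_self
  have hd : d + 1 ≤ 2 ^ (Nat.log 2 d + 1) := Nat.lt_pow_succ_log_self Nat.one_lt_two d
  have hn : n + 2 ≤ 2 ^ (n + 1) := Nat.lt_two_pow_self
  refine Nat.succ_le_succ (Nat.size_le.2 ?_)
  calc (Q + 1) * (d + 1) * (n + 2) ≤ 2 ^ Q * 2 ^ (Nat.log 2 d + 1) * 2 ^ (n + 1) := by gcongr
    _ = 2 ^ (Q + Nat.log 2 d + n + 2) := by rw [← pow_add, ← pow_add]; congr 1; omega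
    _ < 2 ^ (Q + Nat.log 2 d + n + 3) := Nat.pow_lt_pow_right Nat.one_lt_two (by omega)

theorem columnCost_lt {n d S : ℕ} (hS : 1 ≤ S) (hnS : n ≤ S) (hdS : Nat.log 2 d ≤ S) :
    columnCost n d S < 60 * S ^ 2 := by
  rw [columnCost]
  nlinarith

theorem instructionCount_le {n m d S : ℕ} (hS : 1 ≤ S) (hmS : m ≤ S) (hnS : n ≤ S)
    (hdS : Nat.log 2 d ≤ S) :
    m * (n * (columnCost n d S + 1) + 13) + 12 ≤ 85 * S ^ 4 := by
  have hcolumn : columnCost n d S + 1 ≤ 60 * S ^ 2 := columnCost_lt hS hnS hdS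
  have hpow : ∀ k, 1 ≤ S ^ k := fun k => Nat.one_le_pow k S hS
  calc m * (n * (columnCost n d S + 1) + 13) + 12
      ≤ S * (S * (60 * S ^ 2) + 13 * S ^ 3) + 12 * S ^ 4 := by
        gcongr
        · exact Nat.le_mul_of_pos_right 13 (hpow 3)
        · exact Nat.le_mul_of_pos_right 12 (hpow 4)
    _ = 85 * S ^ 4 := by ring

theorem outputsInTime_extractorProgram {n m d q₀ S : ℕ} {setStart : Program} (hq₀ : 2 ≤ q₀)
    (hm1 : 1 ≤ m) (hm : m ≤ n) (hd : 1 ≤ d) (hnS : n ≤ S) (hdS : Nat.log 2 d ≤ S)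
    (hS : ∀ j < n, primeFrom q₀ j ≤ S) (hstart : SetsStart setStart n m d q₀) :
    OutputsInTime (extractorProgram setStart) [n, m, d]
      ((List.range m).flatMap (rowOutput n m q₀ d)) (600 * S ^ 5) := by
  have hn : n + 2 ≤ (S + 1) * (d + 1) * (n + 2) := Nat.le_mul_of_pos_left _ (by positivity)
  have hSd : (S + 1) * (d + 1) ≤ (S + 1) * (d + 1) * (n + 2) :=
    Nat.le_mul_of_pos_right _ (by positivity)
  have hdN : d + 1 ≤ (S + 1) * (d + 1) := Nat.le_mul_of_pos_left _ (by positivity)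
  have hSN : S + 1 ≤ (S + 1) * (d + 1) := Nat.le_mul_of_pos_right _ (by positivity)
  have he : ∀ j < n, primePowerFrom q₀ d j ≤ (S + 1) * (d + 1) * (n + 2) := fun j hj =>
    (primePowerFrom_le q₀ j (by omega)).trans
      ((Nat.mul_le_mul ((hS j hj).trans S.le_succ) d.le_succ).trans hSd)
  obtain ⟨t, ht, htle⟩ := runs_extractorProgram hq₀ (by omega) hm1 hm (by omega) hS (by omega) he
    hstart
  refine ⟨_, t, ht, rfl, htle.trans ?_⟩
  calc _ ≤ 85 * S ^ 4 * (7 * S) :=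
        Nat.mul_le_mul (instructionCount_le (by omega) (by omega) hnS hdS)
          ((bitCost_mul_le S d n).trans (by omega))
    _ = 595 * S ^ 5 := by ring
    _ ≤ 600 * S ^ 5 := Nat.mul_le_mul_right _ (by norm_num)

theorem OutputsInTime.mono {p : Program} {l o : List ℕ} {T T' : ℕ} (h : OutputsInTime p l o T)
    (hT : T ≤ T') : OutputsInTime p l o T' := by
  obtain ⟨s, t, hexec, hout, ht⟩ := h
  exact ⟨s, t, hexec, hout, ht.trans hT⟩

theorem isRankExtractor_map_onesMatrix {F : Type u} [Field F] [IsAlgClosed F] {n m : ℕ}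
    (hmn : m = 1 ∨ m + 1 = n ∨ m = n) (hm : m ≤ n) (q₀ d : ℕ) :
    IsRankExtractor d fun i => MvPolynomial.map (Int.castRingHom F)
      (diagonalPolys (onesMatrix m n) (fun j : Fin n => primePowerFrom q₀ d j) i) := by
  simp only [map_diagonalPolys]
  exact isRankCondenser_diagonalPolys (isRegularMatrix_onesMatrix hmn) hm
    (fun j => lt_primePowerFrom q₀ d j)
    fun _ _ h => coprime_primePowerFrom q₀ d (Fin.val_ne_of_ne h)

theorem totalDegree_diagonalPolys_le_of_forall {R : Type*} [CommRing R] {n m : ℕ} {D : ℝ}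
    (hn : 1 ≤ n) (c : Matrix (Fin m) (Fin n) R) {e : Fin n → ℕ} (he : ∀ j, (e j : ℝ) ≤ D)
    (i : Fin m) : ((diagonalPolys c e i).totalDegree : ℝ) ≤ D := by
  have : Nonempty (Fin n) := ⟨⟨0, hn⟩⟩
  obtain ⟨j, hj⟩ := Finite.exists_max e
  exact (Nat.cast_le.2 (totalDegree_diagonalPolys_le c hj i)).trans (he j)

theorem isExplicitExtractorConstruction_extractorProgram {setStart : Program} {q₀ : ℕ → ℕ}
    {degBound : ℕ → ℕ → ℝ} {timeBound : ℕ → ℕ → ℕ} (hq₀ : ∀ d, 1 ≤ d → 2 ≤ q₀ d)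
    (hstart : ∀ n m d, SetsStart setStart n m d (q₀ d))
    (hdeg : ∀ n d, 1 ≤ d → ∀ j < n, (primePowerFrom (q₀ d) d j : ℝ) ≤ degBound n d)
    (htime : ∀ n d, 1 ≤ n → 1 ≤ d → ∃ S, n ≤ S ∧ Nat.log 2 d ≤ S ∧
      (∀ j < n, primeFrom (q₀ d) j ≤ S) ∧ 600 * S ^ 5 ≤ timeBound n d) :
    IsExplicitExtractorConstruction.{u} (extractorProgram setStart) degBound timeBound := by
  intro n m d hn hd hm1 hmn
  have hm : m ≤ n := by omega
  have hentry : ∀ i j, onesMatrix m n i j = 0 ∨ onesMatrix m n i j = 1 ∨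
      onesMatrix m n i j = -1 := fun i j => (onesMatrix_eq_zero_or_one i j).imp_right .inl
  obtain ⟨S, hnS, hdS, hS, hT⟩ := htime n d hn hd
  refine ⟨onesMatrix m n, fun j => primePowerFrom (q₀ d) d j, _, hentry,
    fun j => lt_primePowerFrom _ _ _,
    fun j l h => coprime_primePowerFrom _ _ (Fin.val_ne_of_ne h), fun i s => ?_,
    totalDegree_diagonalPolys_le_of_forall hn _ fun j => hdeg n d hd j j.2,
    isSparseEncoding_rowOutput (q₀ d) d hm,
    (outputsInTime_extractorProgram (hq₀ d hd) hm1 hm hd hnS hdS hS (hstart n m d)).mono hT,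
    fun F _ _ => isRankExtractor_map_onesMatrix hmn hm (q₀ d) d⟩
  rcases coeff_diagonalPolys (onesMatrix m n) (fun j => primePowerFrom_pos (q₀ d) d j) i s
    with h | ⟨j, h⟩
  · exact .inl h
  · simpa only [h] using hentry i j

theorem logb_two_natCast_le {x k : ℕ} (hx : 1 ≤ x) (h : x ≤ 2 ^ k) : Real.logb 2 x ≤ k := by
  rw [Real.logb_le_iff_le_rpow one_lt_two (by exact_mod_cast hx), Real.rpow_natCast]
  exact_mod_cast h

theorem primeFrom_succ_le {n d j : ℕ} (hd : 1 ≤ d) (hj : j < n) :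
    (primeFrom (d + 1) j : ℝ) ≤ 8 * ((n + d) * Real.logb 2 (n + d)) := by
  exact_mod_cast primeFrom_le (q₀ := d + 1) (N := n + d) (by omega) (by omega)

theorem primeFrom_succ_le_sq {n d j : ℕ} (hd : 1 ≤ d) (hj : j < n) :
    primeFrom (d + 1) j ≤ 8 * (n + d) ^ 2 := by
  have hlog := logb_two_natCast_le (x := n + d) (by omega) Nat.lt_two_pow_self.le
  push_cast at hlog
  have h : (primeFrom (d + 1) j : ℝ) ≤ 8 * ((n + d) * (n + d)) :=
    (primeFrom_succ_le hd hj).trans (by gcongr)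
  rw [sq]
  exact_mod_cast h

theorem primeFrom_two_le {n j : ℕ} (hj : j < n) :
    (primeFrom 2 j : ℝ) ≤ 16 * (n * Real.logb 2 (n + 1)) := by
  have h := primeFrom_le (q₀ := 2) (j := j) (N := n + 1) le_rfl (by omega)
  push_cast at h
  have hn : (1 : ℝ) ≤ n := by exact_mod_cast Nat.one_le_of_lt hj
  have hlog : 0 ≤ Real.logb 2 ((n : ℝ) + 1) := Real.logb_nonneg one_lt_two (by linarith)
  linarith [mul_le_mul_of_nonneg_right hn hlog]

theorem primeFrom_two_le_sq {n j : ℕ} (hj : j < n) : primeFrom 2 j ≤ 16 * n ^ 2 := by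
  have hlog := logb_two_natCast_le (x := n + 1) (by omega) Nat.lt_two_pow_self
  push_cast at hlog
  have h : (primeFrom 2 j : ℝ) ≤ 16 * (n * n) := (primeFrom_two_le hj).trans (by gcongr)
  rw [sq]
  exact_mod_cast h

theorem primePowerFrom_two_le {n d j : ℕ} (hd : 1 ≤ d) (hj : j < n) :
    (primePowerFrom 2 d j : ℝ) ≤ 16 * (n * d * Real.logb 2 (n + 1)) := by
  calc (primePowerFrom 2 d j : ℝ) ≤ primeFrom 2 j * d := by
        exact_mod_cast primePowerFrom_le 2 j (by omega)
    _ ≤ 16 * (n * Real.logb 2 (n + 1)) * d := by gcongr; exact primeFrom_two_le hj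
    _ = 16 * (n * d * Real.logb 2 (n + 1)) := by ring

theorem runningTime_le_mul_pow {X C : ℕ} (hX : 1 ≤ X) (hC : 600 * 16 ^ 5 ≤ C) :
    600 * (16 * X ^ 2) ^ 5 ≤ C * X ^ C := by
  calc 600 * (16 * X ^ 2) ^ 5 = 600 * 16 ^ 5 * X ^ 10 := by ring
    _ ≤ C * X ^ C := Nat.mul_le_mul hC (Nat.pow_le_pow_right hX (le_trans (by norm_num) hC))

theorem exists_construction_polynomial_in_degree : ∃ (prog : Program) (C : ℕ),
    IsExplicitExtractorConstruction.{u} prog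
      (fun n d => C * ((n + d) * Real.logb 2 (n + d))) (fun n d => C * (n + d) ^ C) := by
  obtain ⟨C, hC⟩ : ∃ C : ℕ, 600 * 16 ^ 5 ≤ C := ⟨_, le_rfl⟩
  refine ⟨extractorProgram (.add Register.start Register.bound Register.zero), C,
    isExplicitExtractorConstruction_extractorProgram (q₀ := fun d => d + 1)
      (fun _ hd => Nat.succ_le_succ hd) (fun _ _ _ _ _ hN => Runs.add) ?_ ?_⟩
  · intro n d hd j hj
    have hlog : 0 ≤ Real.logb 2 ((n : ℝ) + d) :=
      Real.logb_nonneg one_lt_two (by exact_mod_cast (by omega : 1 ≤ n + d))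
    have hC8 : (8 : ℝ) ≤ C := by exact_mod_cast le_trans (by norm_num) hC
    rw [primePowerFrom_of_lt j d.lt_succ_self]
    exact (primeFrom_succ_le hd hj).trans (by gcongr)
  · intro n d hn hd
    have hsq : n + d ≤ (n + d) ^ 2 := Nat.le_self_pow two_ne_zero _
    have hdlog : Nat.log 2 d ≤ d := Nat.log_le_self 2 d
    exact ⟨16 * (n + d) ^ 2, by omega, by omega,
      fun j hj => (primeFrom_succ_le_sq hd hj).trans (by gcongr; norm_num),
      runningTime_le_mul_pow (by omega) hC⟩

theorem exists_construction_polynomial_in_log_degree : ∃ (prog : Program) (C : ℕ),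
    IsExplicitExtractorConstruction.{u} prog
      (fun n d => C * (n * d * Real.logb 2 (n + 1))) (fun n d => C * (n + Nat.log 2 d) ^ C) := by
  obtain ⟨C, hC⟩ : ∃ C : ℕ, 600 * 16 ^ 5 ≤ C := ⟨_, le_rfl⟩
  refine ⟨extractorProgram (.const Register.start 2), C,
    isExplicitExtractorConstruction_extractorProgram (q₀ := fun _ => 2) (fun _ _ => le_rfl)
      (fun _ _ _ _ hN _ => Runs.mono Runs.const (by omega)) ?_ ?_⟩
  · intro n d hd j hj
    have hlog : 0 ≤ Real.logb 2 ((n : ℝ) + 1) := Real.logb_nonneg one_lt_two (by simp)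
    have hC16 : (16 : ℝ) ≤ C := by exact_mod_cast le_trans (by norm_num) hC
    exact (primePowerFrom_two_le hd hj).trans (by gcongr)
  · intro n d hn _
    have hsq : n + Nat.log 2 d ≤ (n + Nat.log 2 d) ^ 2 := Nat.le_self_pow two_ne_zero _
    exact ⟨16 * (n + Nat.log 2 d) ^ 2, by omega, by omega,
      fun j hj => (primeFrom_two_le_sq hj).trans (by gcongr; omega),
      runningTime_le_mul_pow (by omega) hC⟩

end Construction

end RankExtractor

end

theorem mainTheorem3 :
    -- the construction from a `k`-regular matrix and pairwise coprime exponents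
    (∀ (F : Type u) [Field F] [IsAlgClosed F] (n d m k : ℕ),
      1 ≤ n → 1 ≤ d → 1 ≤ m → m ≤ n → 1 ≤ k → k ≤ n →
      ∀ (M : Matrix (Fin m) (Fin n) F) (e : Fin n → ℕ),
        RankExtractor.IsRegularMatrix k M →
        (∀ j, d < e j) → Pairwise (fun j j' => Nat.Coprime (e j) (e j')) →
        (∀ V : Set (Fin n → F), RankExtractor.IsAffineVariety V →
          RankExtractor.dim V ≤ (k : WithBot ℕ∞) → RankExtractor.degree V ≤ (d : ℕ∞) →
          ∀ b : Fin m → F,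
            (RankExtractor.polyMap (RankExtractor.diagonalPolys M e) ⁻¹' {b} ∩ V).Finite) ∧
        RankExtractor.IsRankCondenser k d (RankExtractor.diagonalPolys M e) ∧
        (m = k → RankExtractor.IsRankExtractor d (RankExtractor.diagonalPolys M e))) ∧
    -- degree `O((n + d) log (n + d))` in time `poly(n, d)`
    (∃ (prog : RankExtractor.Program) (C : ℕ),
      RankExtractor.IsExplicitExtractorConstruction.{u} prog
        (fun n d => C * ((n + d) * Real.logb 2 (n + d)))
        (fun n d => C * (n + d) ^ C)) ∧
    -- degree `O(n d log (n + 1))` in time `poly(n, log d)`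
    (∃ (prog : RankExtractor.Program) (C : ℕ),
      RankExtractor.IsExplicitExtractorConstruction.{u} prog
        (fun n d => C * (n * d * Real.logb 2 (n + 1)))
        (fun n d => C * (n + Nat.log 2 d) ^ C)) := by
  refine ⟨fun F _ _ n d m k _ _ _ _ _ hkn M e hM hd he => ⟨fun V hV hdim hdeg b =>
    (RankExtractor.isIntegralOn_diagonalPolys hV hM hkn hd he hdim hdeg).finite_fiber b,
    RankExtractor.isRankCondenser_diagonalPolys hM hkn hd he, ?_⟩,
    RankExtractor.exists_construction_polynomial_in_degree,
    RankExtractor.exists_construction_polynomial_in_log_degree⟩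
  rintro rfl
  exact RankExtractor.isRankCondenser_diagonalPolys hM hkn hd he
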